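/- **Conventions.** Write $\log x=\max\{1,\log_2 x\}$, and let $\Omega\subset[0,\pi/2]$. *Lacunary sets.* A sequence $(\omega_n)$ of reals is *lacunary with ratio $A$, converging to $p$*, if $\omega_n\ne p$ and $|\omega_{n+1}-p|<A\,|\omega_n-p|$ for all $n$. A set is *lacunary of order $1$* if it is contained in (the range of) a lacunary sequence with some ratio $A<1$ converging to some point $p$. A set is *lacunary of order $M+1$* if there are a set $\Omega'$ lacunary of order $M$ and a number $A<1$ such that it is covered by the union of $\Omega'$ with lacunary sequences with ratio $A$ converging to the points $p$ of $\Omega'$, at most two for each $p$, where no point of $\Omega'$ lies strictly between $p$ and a term of a sequence attached to $p$. *Minkowski dimension.* The upper Minkowski dimension of $\Omega$ is the infimum of the exponents $s\ge 0$ such that for all sufficiently small $\delta>0$ the set $\Omega$ can be covered by $O(\delta^{-s})$ intervals of length $\delta$. *Rectangles.* For $\alpha\in\mathbb R$ and an integer $N\ge1$ let $V$ be the square $[0,N^{1/2}]^2$ rotated counterclockwise by the angle $\alpha$ about the origin, and let $\mathcal A_{\Omega,\alpha}$ be the family of all (closed, non-degenerate) rectangles $R\subset V$ which have a side that is parallel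 to a side of $V$ or makes an angle $\theta-\alpha$ with the $x$-axis for some $\theta\in\Omega$. For $\omega\in[0,1]^2$ put $\mathbb Z^2_\omega=\omega+\mathbb Z^2$ and $D(\mathbb Z^2_\omega,R)=\#(\mathbb Z^2_\omega\cap R)-|R|$. *Rotation angles.* Let $\Omega^*=\Omega\cup\{0\}\cup(\Omega+\pi/2)\cup\{\pi/2\}$. **Lemma 5.1.** 1) Let $\Omega$ be a lacunary set of order $M\ge1$. There is $\alpha\in[0,\pi/2]$ for which there is $c>0$ with $$\Bigl|\tan(\alpha-\theta)-\frac pq\Bigr|>\frac{c}{q^2\log^{2M}q}\qquad\text{for all }\theta\in\Omega^*,\ p\in\mathbb Z,\ q\in\mathbb N, \tag{1}$$ and for every real $\alpha$ that satisfies (1) for some $c>0$ there is a constant $C$ such that for all $N\ge1$ and all $R\in\mathcal A_{\Omega,\alpha}$ $$\int_{[0,1]^2}|D(\mathbb Z^2_\omega,R)|^2\,d\omega\le C\log^{4M+1}N.$$ 2) Let $\Omega$ have upper Minkowski dimension $d<1$, and let $\tau=\frac{2}{(1-d)^2}-2$ satisfy $\tau<1$. For $\eta>0$ consider the condition that there is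 $c>0$ with $$\Bigl|\tan(\alpha-\theta)-\frac pq\Bigr|>c\,q^{-\frac{2}{(1-d)^2}-\eta}\qquad\text{for all }\theta\in\Omega^*,\ p\in\mathbb Z,\ q\in\mathbb N. \tag{2$_\eta$}$$ There is a real $\alpha$ that satisfies (2$_\eta$) for every $\eta>0$. Moreover, for every $\varepsilon>0$ there is $\eta>0$ such that for every real $\alpha$ that satisfies (2$_\eta$) there is a constant $C$ such that for all $N\ge1$ and all $R\in\mathcal A_{\Omega,\alpha}$ $$\int_{[0,1]^2}|D(\mathbb Z^2_\omega,R)|^2\,d\omega\le C\,N^{\frac{\tau}{\tau+1}+\varepsilon}.$$ In particular, in both cases one angle $\alpha$, independent of $N$, $R$ (and $\varepsilon$), serves for all the bounds. The integrands are integrable. -/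

import Mathlib

open Set MeasureTheory

noncomputable section

namespace DirDisc

/-- The convention `log n = max {1, log₂ n}`. -/
def log2 (x : ℝ) : ℝ := max 1 (Real.logb 2 x)

/-- `ω` is a lacunary sequence with ratio bound `A` converging to the point `p`: the distances
`|ω n - p|` are positive and the quotients of consecutive ones are smaller than `A`
(a condition of interest when `A < 1`). -/
def IsLacunarySeq (A p : ℝ) (ω : ℕ → ℝ) : Prop :=
  ∀ n, ω n ≠ p ∧ |ω (n + 1) - p| < A * |ω n - p|

/-- Lacunary sets of finite order. Order one: (part of) a lacunary sequence. Order `M + 1`: covered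
by the union of a lacunary set `Ω'` of order `M` with lacunary sequences converging to every point
of `Ω'` (at most two per point, e.g. one from each side). The ratio bound `A` is common to all the
points `p` of `Ω'`, and a sequence attached to `p` lives in the gaps of `Ω'` next to `p`: no point
of `Ω'` lies strictly between `p` and a term of the sequence. -/
inductive IsLacunaryOfOrder : ℕ → Set ℝ → Prop
  | one (Ω : Set ℝ) (A p : ℝ) (ω : ℕ → ℝ) (hA : A < 1) (hω : IsLacunarySeq A p ω)
      (hΩ : Ω ⊆ range ω) : IsLacunaryOfOrder 1 Ω
  | succ (M : ℕ) (Ω Ω' : Set ℝ) (h : IsLacunaryOfOrder M Ω') (A : ℝ) (σ ρ : ℝ → ℕ → ℝ)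
      (hA : A < 1)
      (hσ : ∀ p ∈ Ω', IsLacunarySeq A p (σ p) ∧ ∀ n, Disjoint Ω' (uIoo p (σ p n)))
      (hρ : ∀ p ∈ Ω', IsLacunarySeq A p (ρ p) ∧ ∀ n, Disjoint Ω' (uIoo p (ρ p n)))
      (hΩ : Ω ⊆ Ω' ∪ ⋃ p ∈ Ω', (range (σ p) ∪ range (ρ p))) : IsLacunaryOfOrder (M + 1) Ω

/-- For all small `δ > 0` the set `Ω` is covered by `O(δ ^ (-s))` intervals of length `δ`. -/
def IsCoveringExponent (Ω : Set ℝ) (s : ℝ) : Prop :=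
  ∃ C δ₀ : ℝ, 0 < δ₀ ∧ ∀ δ : ℝ, 0 < δ → δ < δ₀ →
    ∃ t : Finset ℝ, (t.card : ℝ) ≤ C * δ ^ (-s) ∧ Ω ⊆ ⋃ c ∈ t, Icc c (c + δ)

/-- The upper Minkowski dimension of a (bounded) set of reals. -/
def upperMinkowskiDim (Ω : Set ℝ) : ℝ :=
  sInf {s : ℝ | 0 ≤ s ∧ IsCoveringExponent Ω s}

/-- The directions `Ω ∪ {0} ∪ (Ω + π/2) ∪ {π/2}`, which account for both pairs of sides of the
rectangles and of the large square. -/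
def directions (Ω : Set ℝ) : Set ℝ :=
  Ω ∪ {0} ∪ (fun θ => θ + Real.pi / 2) '' Ω ∪ {Real.pi / 2}

/-- The Diophantine property of the rotation angle for lacunary sets of order `M`. -/
def IsLogAngle (M : ℕ) (Ω : Set ℝ) (α : ℝ) : Prop :=
  ∃ c : ℝ, 0 < c ∧ ∀ θ ∈ directions Ω, ∀ (p : ℤ) (q : ℕ), 1 ≤ q →
    c / ((q : ℝ) ^ 2 * log2 q ^ (2 * M)) < |Real.tan (α - θ) - (p : ℝ) / (q : ℝ)|

/-- The Diophantine property, with loss `η`, of the rotation angle for sets of upper Minkowski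
dimension `d`. -/
def IsPowerAngle (d η : ℝ) (Ω : Set ℝ) (α : ℝ) : Prop :=
  ∃ c : ℝ, 0 < c ∧ ∀ θ ∈ directions Ω, ∀ (p : ℤ) (q : ℕ), 1 ≤ q →
    c * (q : ℝ) ^ (-(2 / (1 - d) ^ 2) - η) < |Real.tan (α - θ) - (p : ℝ) / (q : ℝ)|

/-- The closed rectangle with a vertex at `c`, a side of length `a` from `c` in the direction of
angle `φ` with the `x`-axis, and a side of length `b` from `c` in the direction `φ + π/2`. -/
def rectangle (φ : ℝ) (c : ℝ × ℝ) (a b : ℝ) : Set (ℝ × ℝ) :=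
  {x | ∃ s ∈ Icc 0 a, ∃ t ∈ Icc 0 b,
    x = (c.1 + s * Real.cos φ - t * Real.sin φ, c.2 + s * Real.sin φ + t * Real.cos φ)}

/-- The square `[0, √N]²` rotated counterclockwise by `α` about the origin. -/
def bigSquare (α : ℝ) (N : ℕ) : Set (ℝ × ℝ) := rectangle α (0, 0) (√N) (√N)

/-- The family of all rectangles `R ⊆ V` which have a side that is parallel to a side of
`V = bigSquare α N`, or that makes the angle `θ - α` with the `x`-axis for some `θ ∈ Ω`. -/
def admissibleRectangles (Ω : Set ℝ) (α : ℝ) (N : ℕ) : Set (Set (ℝ × ℝ)) :=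
  {R | ∃ (φ : ℝ) (c : ℝ × ℝ) (a b : ℝ), (φ = α ∨ ∃ θ ∈ Ω, φ = θ - α) ∧ 0 < a ∧ 0 < b ∧
    R = rectangle φ c a b ∧ R ⊆ bigSquare α N}

/-- The shifted integer lattice `ω + ℤ²`. -/
def shiftedLattice (ω : ℝ × ℝ) : Set (ℝ × ℝ) :=
  range fun m : ℤ × ℤ => (ω.1 + (m.1 : ℝ), ω.2 + (m.2 : ℝ))

/-- The discrepancy `D(P, R) = #(P ∩ R) - |R|`. -/
def discrepancy (P R : Set (ℝ × ℝ)) : ℝ := ((P ∩ R).ncard : ℝ) - volume.real R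

/-- The mean square over all shifts `ω ∈ [0,1]²` of the discrepancy of `ω + ℤ²` in `R` exists and
is at most `B`. -/
def MeanSquareDiscrepancyLE (R : Set (ℝ × ℝ)) (B : ℝ) : Prop :=
  IntegrableOn (fun ω : ℝ × ℝ => |discrepancy (shiftedLattice ω) R| ^ 2)
      (Icc (0 : ℝ) 1 ×ˢ Icc (0 : ℝ) 1) ∧
    ∫ ω in Icc (0 : ℝ) 1 ×ˢ Icc (0 : ℝ) 1, |discrepancy (shiftedLattice ω) R| ^ 2 ≤ B

end DirDisc

end

open Set MeasureTheory

noncomputable section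

namespace DirDisc

/-! Discrepancy. The count of `ω + ℤ²` in `R` is a periodic function of `ω` whose Fourier
coefficients are the values of the Fourier transform of the indicator of `R` at integer points, and
the coefficient at `0` is the area. By Parseval the mean square discrepancy is the sum of the
squared transforms over `n ≠ 0` (`meanSquareDiscrepancyLE_of_sum_le`). For a rectangle the transform
is a product of two factors, each at most `min (X, 1/|u|)` with `X = √(2N)`, where `u` is one of two
linear forms in `n` in orthogonal directions. Their squares add up to `|n|²`, so for `|n| ≈ 2 ^ k`
one squared factor is `O(4 ^ (-k))`. The Diophantine condition makes the values of each form `g (k +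
2)`-separated and away from zero on the dyadic shell, so the other squared factor sums to `O(min
(1/g², X/g))` (`sum_linForm_le`). Summing over `k` gives `meanSquareDiscrepancyLE_of_linFormBound`.

With `g k ≈ 2 ^ (-k) k ^ (-2M)`, each of the first `log N` shells contributes at most `O(log ^ (4M)
N)` and the rest decays geometrically. With `g k ≈ 2 ^ (-k (1 + β))` and `β` slightly above `τ`,
interpolating between the two bounds makes the shells summable and leaves the power of `N`.

The angle. `Ω` enters only through covering numbers `K δ`. They are `O(log ^ M (1/δ))` for lacunary
sets: a sequence needs `O(log (1/δ))` intervals, and the gap condition lets at most two limit points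
in each covering interval send terms out of it. For dimension `d` they are `O(δ ^ (-s))` for every
`s > d`.

The angle is the common point of nested intervals. In an interval of length `ℓ`, fractions with `q²
ℓ` small are so far apart that, for all directions in one interval of length `ℓ'/10`, the bad angles
lie within `ℓ'/2` of a single point (`abs_sub_le_of_near_fractions`). A subinterval of length `ℓ'`
avoiding all of them exists once `(2 K(ℓ'/10) + 1) ℓ' < ℓ`. A given `q` is first handled at the
interval after the first one with `q² ℓ` small, so passing from `1/q²` to the final distance takes
two steps (`exists_badly_approximable_angle`). Each step costs a factor `log ^ M q` or a power `1/(1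
- s)`, whence the exponents `2M` and `2/(1 - d)²`. -/

/-- The half-open unit square. -/
def unitSquare : Set (ℝ × ℝ) := Ioc 0 1 ×ˢ Ioc 0 1

/-- The character `x ↦ exp (-2πi ⟨n, x⟩)` of the plane. -/
def character (n : ℤ × ℤ) (x : ℝ × ℝ) : ℂ :=
  Complex.exp (-(2 * Real.pi * Complex.I * (n.1 * x.1 + n.2 * x.2)))

/-! ### Parseval's identity on the unit square -/

section Torus

local instance : MeasureSpace UnitAddCircle := ⟨AddCircle.haarAddCircle⟩

local instance : Measure.IsAddHaarMeasure (volume : Measure UnitAddCircle) :=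
  inferInstanceAs (Measure.IsAddHaarMeasure AddCircle.haarAddCircle)

local instance : IsProbabilityMeasure (volume : Measure UnitAddCircle) :=
  inferInstanceAs (IsProbabilityMeasure AddCircle.haarAddCircle)

/-- The representative in `(0, 1]` of a point of the circle. -/
def circleRep (z : UnitAddCircle) : ℝ := (AddCircle.equivIoc 1 0 z : ℝ)

theorem measurable_circleRep : Measurable circleRep :=
  measurable_subtype_coe.comp (AddCircle.measurableEquivIoc 1 0).measurable

theorem circleRep_coe {x : ℝ} (hx : x ∈ Ioc (0 : ℝ) 1) : circleRep (x : UnitAddCircle) = x := by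
  unfold circleRep
  have h := (AddCircle.equivIoc (1 : ℝ) 0).apply_symm_apply ⟨x, by simpa using hx⟩
  exact congrArg Subtype.val h

theorem integral_torus_eq (h : UnitAddTorus (Fin 2) → ℂ) (g : ℝ × ℝ → ℂ)
    (hg : ∀ x : Fin 2 → ℝ, (∀ i, x i ∈ Ioc (0 : ℝ) 1) →
      h (fun i => (x i : UnitAddCircle)) = g (x 0, x 1)) :
    ∫ x, h x = ∫ y in unitSquare, g y := by
  rw [UnitAddTorus.integral_preimage h (fun _ => 0)]
  have hs : {x : Fin 2 → ℝ | ∀ i, x i ∈ Ioc (0 : ℝ) (0 + 1)} =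
      (MeasurableEquiv.finTwoArrow : (Fin 2 → ℝ) ≃ᵐ ℝ × ℝ) ⁻¹' unitSquare := by
    ext x
    simp [unitSquare, Fin.forall_fin_two, MeasurableEquiv.finTwoArrow]
  rw [hs, ← (volume_preserving_finTwoArrow ℝ).setIntegral_preimage_emb
    (MeasurableEquiv.measurableEmbedding _)]
  refine setIntegral_congr_fun ?_ ?_
  · exact (MeasurableEquiv.measurable _) (measurableSet_Ioc.prod measurableSet_Ioc)
  · intro x hx
    rw [← hs] at hx
    exact hg x (by simpa using hx)

/-- Parseval's identity on the unit square. -/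
theorem hasSum_sq_fourier (F : ℝ × ℝ → ℂ) (hF : Measurable F) (B : ℝ) (hB : ∀ x, ‖F x‖ ≤ B) :
    HasSum (fun n : ℤ × ℤ => ‖∫ y in unitSquare, character n y * F y‖ ^ 2)
      (∫ y in unitSquare, ‖F y‖ ^ 2) := by
  -- `F` need not be periodic; only its values on the half-open square are transported to the torus.
  set f : UnitAddTorus (Fin 2) → ℂ := fun x => F (circleRep (x 0), circleRep (x 1)) with hf
  have hfm : Measurable f := hF.comp
    ((measurable_circleRep.comp (measurable_pi_apply 0)).prodMk
      (measurable_circleRep.comp (measurable_pi_apply 1)))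
  have hL : MemLp f 2 (volume : Measure (UnitAddTorus (Fin 2))) :=
    MemLp.of_bound hfm.aestronglyMeasurable B (Filter.Eventually.of_forall fun x => hB _)
  have key := UnitAddTorus.hasSum_sq_mFourierCoeff (MemLp.toLp f hL)
  have hcoe : ∀ x : Fin 2 → ℝ, (∀ i, x i ∈ Ioc (0 : ℝ) 1) →
      f (fun i => (x i : UnitAddCircle)) = F (x 0, x 1) := by
    intro x hx
    simp only [hf, circleRep_coe (hx 0), circleRep_coe (hx 1)]
  have h1 : (∫ x, ‖(MemLp.toLp f hL) x‖ ^ 2) = ∫ y in unitSquare, ‖F y‖ ^ 2 := by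
    have e1 : (∫ x, ‖(MemLp.toLp f hL) x‖ ^ 2) = ∫ x, ‖f x‖ ^ 2 := by
      apply integral_congr_ae
      filter_upwards [hL.coeFn_toLp] with x hx
      rw [hx]
    rw [e1]
    apply Complex.ofReal_injective
    rw [← integral_complex_ofReal, ← integral_complex_ofReal]
    refine integral_torus_eq _ (fun y => ((‖F y‖ ^ 2 : ℝ) : ℂ)) ?_
    intro x hx
    rw [hcoe x hx]
  have h2 : ∀ n : Fin 2 → ℤ, UnitAddTorus.mFourierCoeff (MemLp.toLp f hL) n =
      ∫ y in unitSquare, character (n 0, n 1) y * F y := by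
    intro n
    have e1 : UnitAddTorus.mFourierCoeff (MemLp.toLp f hL) n = ∫ x, UnitAddTorus.mFourier (-n) x * f x := by
      apply integral_congr_ae
      filter_upwards [hL.coeFn_toLp] with x hx
      rw [hx, smul_eq_mul]
    rw [e1]
    refine integral_torus_eq _ (fun y => character (n 0, n 1) y * F y) ?_
    intro x hx
    rw [hcoe x hx]
    congr 1
    simp only [UnitAddTorus.mFourier, ContinuousMap.coe_mk, Fin.prod_univ_two, fourier_coe_apply,
      character, ← Complex.exp_add]
    congr 1
    push_cast [Pi.neg_apply]
    ring
  rw [h1] at key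
  simp only [h2] at key
  exact (Equiv.hasSum_iff (finTwoArrowEquiv ℤ)
    (f := fun n : ℤ × ℤ => ‖∫ y in unitSquare, character n y * F y‖ ^ 2)).mp key

end Torus

/-! ### Periodization: lattice point counts and their Fourier coefficients -/

theorem continuous_character (n : ℤ × ℤ) : Continuous (character n) := by
  unfold character; fun_prop

theorem norm_character (n : ℤ × ℤ) (x : ℝ × ℝ) : ‖character n x‖ = 1 := by
  unfold character
  rw [show -(2 * (Real.pi : ℂ) * Complex.I * (n.1 * x.1 + n.2 * x.2)) =
    ((-(2 * Real.pi * (n.1 * x.1 + n.2 * x.2)) : ℝ) : ℂ) * Complex.I by push_cast; ring]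
  exact Complex.norm_exp_ofReal_mul_I _

theorem character_add_int (n m : ℤ × ℤ) (x : ℝ × ℝ) :
    character n (x.1 + m.1, x.2 + m.2) = character n x := by
  unfold character
  rw [Complex.exp_eq_exp_iff_exists_int]
  refine ⟨-(n.1 * m.1 + n.2 * m.2), ?_⟩
  push_cast
  ring

theorem character_zero (x : ℝ × ℝ) : character 0 x = 1 := by
  simp [character]

/-- The number of points of `ω + ℤ²` in a set, counted in a finite box of indices. -/
def boxCount (B : ℕ) (R : Set (ℝ × ℝ)) (ω : ℝ × ℝ) : ℝ :=
  ∑ m ∈ Finset.Icc (-(B : ℤ) - 1) (B + 1) ×ˢ Finset.Icc (-(B : ℤ) - 1) (B + 1),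
    R.indicator (fun _ => (1 : ℝ)) (ω.1 + (m.1 : ℤ), ω.2 + (m.2 : ℤ))

/-- The translate of the half-open unit square by an integer vector. -/
def unitCell (m : ℤ × ℤ) : Set (ℝ × ℝ) :=
  Ioc (m.1 : ℝ) (m.1 + 1) ×ˢ Ioc (m.2 : ℝ) (m.2 + 1)

theorem measurableSet_unitCell (m : ℤ × ℤ) : MeasurableSet (unitCell m) :=
  measurableSet_Ioc.prod measurableSet_Ioc

theorem measurableSet_unitSquare : MeasurableSet unitSquare :=
  measurableSet_Ioc.prod measurableSet_Ioc

theorem iUnion_unitCell : ⋃ m, unitCell m = univ := by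
  refine eq_univ_of_forall fun x => ?_
  have h1 := mem_univ x.1
  have h2 := mem_univ x.2
  rw [← iUnion_Ioc_intCast ℝ, mem_iUnion] at h1 h2
  obtain ⟨i, hi⟩ := h1
  obtain ⟨j, hj⟩ := h2
  exact mem_iUnion.mpr ⟨(i, j), hi, hj⟩

theorem pairwise_disjoint_unitCell : Pairwise (Function.onFun Disjoint unitCell) := by
  intro m m' h
  rw [Function.onFun, Set.disjoint_left]
  rintro x ⟨h1, h2⟩ ⟨h3, h4⟩
  apply h
  have key := pairwise_disjoint_Ioc_intCast ℝ
  refine Prod.ext ?_ ?_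
  · by_contra hne
    exact Set.disjoint_left.mp (key hne) h1 h3
  · by_contra hne
    exact Set.disjoint_left.mp (key hne) h2 h4

theorem setIntegral_unitCell (m : ℤ × ℤ) (h : ℝ × ℝ → ℂ) :
    ∫ x in unitCell m, h x = ∫ y in unitSquare, h (y.1 + m.1, y.2 + m.2) := by
  have hmp : MeasurePreserving (fun y : ℝ × ℝ => y + ((m.1 : ℝ), (m.2 : ℝ))) volume volume :=
    measurePreserving_add_right _ _
  rw [show unitSquare = (fun y : ℝ × ℝ => y + ((m.1 : ℝ), (m.2 : ℝ))) ⁻¹' unitCell m by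
    ext y
    simp [unitSquare, unitCell, add_comm _ (1 : ℝ)]]
  exact (hmp.setIntegral_preimage_emb (measurableEmbedding_addRight _) h _).symm

theorem mem_box_of_mem {B : ℕ} {R : Set (ℝ × ℝ)}
    (hR : R ⊆ Icc (-(B : ℝ)) B ×ˢ Icc (-(B : ℝ)) B) {ω : ℝ × ℝ}
    (hω : ω ∈ Icc (0 : ℝ) 1 ×ˢ Icc (0 : ℝ) 1) {m : ℤ × ℤ}
    (h : ((ω.1 + m.1, ω.2 + m.2) : ℝ × ℝ) ∈ R) :
    m ∈ Finset.Icc (-(B : ℤ) - 1) (B + 1) ×ˢ Finset.Icc (-(B : ℤ) - 1) (B + 1) := by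
  obtain ⟨⟨h1, h2⟩, h3, h4⟩ := hR h
  obtain ⟨⟨h5, h6⟩, h7, h8⟩ := hω
  dsimp only at h1 h2 h3 h4
  simp only [Finset.mem_product, Finset.mem_Icc]
  refine ⟨⟨?_, ?_⟩, ?_, ?_⟩ <;> · rify; linarith

theorem measurable_boxCount {B : ℕ} {R : Set (ℝ × ℝ)} (hR : MeasurableSet R) :
    Measurable (boxCount B R) := by
  unfold boxCount
  refine Finset.measurable_sum _ fun m _ => ?_
  exact (measurable_const.indicator hR).comp (by fun_prop)

theorem boxCount_nonneg {B : ℕ} {R : Set (ℝ × ℝ)} (ω : ℝ × ℝ) : 0 ≤ boxCount B R ω :=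
  Finset.sum_nonneg fun _ _ => Set.indicator_nonneg (fun _ _ => zero_le_one) _

theorem boxCount_le {B : ℕ} {R : Set (ℝ × ℝ)} (ω : ℝ × ℝ) :
    boxCount B R ω ≤
      (Finset.Icc (-(B : ℤ) - 1) (B + 1) ×ˢ Finset.Icc (-(B : ℤ) - 1) (B + 1)).card := by
  unfold boxCount
  refine (Finset.sum_le_card_nsmul _ _ 1 fun m _ => ?_).trans (by simp)
  exact Set.indicator_le_self' (fun _ _ => zero_le_one) _

/-- Replaces a cardinality by a finite sum of translated indicators, from which measurability and
boundedness in `ω` are immediate. -/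
theorem ncard_shiftedLattice_inter {B : ℕ} {R : Set (ℝ × ℝ)}
    (hR : R ⊆ Icc (-(B : ℝ)) B ×ˢ Icc (-(B : ℝ)) B) {ω : ℝ × ℝ}
    (hω : ω ∈ Icc (0 : ℝ) 1 ×ˢ Icc (0 : ℝ) 1) :
    ((shiftedLattice ω ∩ R).ncard : ℝ) = boxCount B R ω := by
  classical
  set Box := Finset.Icc (-(B : ℤ) - 1) (B + 1) ×ˢ Finset.Icc (-(B : ℤ) - 1) (B + 1) with hBox
  set g : ℤ × ℤ → ℝ × ℝ := fun m => (ω.1 + (m.1 : ℝ), ω.2 + (m.2 : ℝ)) with hg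
  have hinj : Function.Injective g := by
    intro m m' h
    simp only [hg, Prod.mk.injEq, add_right_inj, Int.cast_inj] at h
    exact Prod.ext h.1 h.2
  have hset : shiftedLattice ω ∩ R = g '' (Box.filter fun m => g m ∈ R : Finset (ℤ × ℤ)) := by
    ext x
    constructor
    · rintro ⟨⟨m, rfl⟩, hx⟩
      refine ⟨m, ?_, rfl⟩
      rw [Finset.mem_coe, Finset.mem_filter]
      exact ⟨mem_box_of_mem hR hω hx, hx⟩
    · rintro ⟨m, hm, rfl⟩
      rw [Finset.mem_coe, Finset.mem_filter] at hm
      exact ⟨⟨m, rfl⟩, hm.2⟩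
  rw [hset, Set.ncard_image_of_injective _ hinj, Set.ncard_coe_finset, Finset.card_filter]
  push_cast
  unfold boxCount
  refine Finset.sum_congr rfl fun m _ => ?_
  rw [Set.indicator_apply]

/-- Fourier coefficients of the lattice point count are Fourier transforms of the indicator. -/
theorem fourier_boxCount {B : ℕ} {R : Set (ℝ × ℝ)} (hRm : MeasurableSet R)
    (hR : R ⊆ Icc (-(B : ℝ)) B ×ˢ Icc (-(B : ℝ)) B) (n : ℤ × ℤ) :
    ∫ y in unitSquare, character n y * (boxCount B R y : ℂ) = ∫ x in R, character n x := by
  set Box := Finset.Icc (-(B : ℤ) - 1) (B + 1) ×ˢ Finset.Icc (-(B : ℤ) - 1) (B + 1) with hBox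
  set h : ℝ × ℝ → ℂ := R.indicator (character n) with hh
  have hsub : unitSquare ⊆ Icc (0 : ℝ) 1 ×ˢ Icc (0 : ℝ) 1 :=
    Set.prod_mono Ioc_subset_Icc_self Ioc_subset_Icc_self
  have hint : Integrable h := by
    rw [hh, integrable_indicator_iff hRm]
    exact ((continuous_character n).continuousOn.integrableOn_compact
      (isCompact_Icc.prod isCompact_Icc)).mono_set hR
  -- Unfolding: the integer translates of the half-open square tile the plane, only finitely many of
  -- them meet `R`, and the character is unchanged by integer translations.
  have hsum := hasSum_integral_iUnion (f := h) (μ := volume) measurableSet_unitCell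
    pairwise_disjoint_unitCell hint.integrableOn
  rw [iUnion_unitCell, setIntegral_univ, hh, integral_indicator hRm, ← hh] at hsum
  have hfin : HasSum (fun m => ∫ x in unitCell m, h x) (∑ m ∈ Box, ∫ x in unitCell m, h x) := by
    refine hasSum_sum_of_ne_finset_zero fun m hm => ?_
    rw [setIntegral_unitCell]
    rw [setIntegral_congr_fun (g := fun _ => 0) measurableSet_unitSquare, integral_zero]
    intro y hy
    refine Set.indicator_of_notMem ?_ _
    exact fun hy' => hm (mem_box_of_mem hR (hsub hy) hy')
  rw [hsum.unique hfin]
  have hint' : ∀ m ∈ Box, IntegrableOn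
      (fun y : ℝ × ℝ => h (y.1 + (m.1 : ℝ), y.2 + (m.2 : ℝ))) unitSquare := by
    intro m _
    exact ((measurePreserving_add_right (volume : Measure (ℝ × ℝ))
      ((m.1 : ℝ), (m.2 : ℝ))).integrable_comp_of_integrable hint).integrableOn
  simp only [setIntegral_unitCell]
  rw [← integral_finsetSum _ hint']
  refine integral_congr_ae (Filter.Eventually.of_forall fun y => ?_)
  simp only [boxCount, Complex.ofReal_sum, Finset.mul_sum]
  refine Finset.sum_congr rfl fun m _ => ?_
  by_cases hm : ((y.1 + (m.1 : ℝ), y.2 + (m.2 : ℝ)) : ℝ × ℝ) ∈ R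
  · simp [hh, Set.indicator_of_mem hm, character_add_int]
  · simp [hh, Set.indicator_of_notMem hm]

/-- The mean square discrepancy is controlled by the nonzero frequencies of the indicator. -/
theorem meanSquareDiscrepancyLE_of_sum_le {B : ℕ} {R : Set (ℝ × ℝ)} (hRm : MeasurableSet R)
    (hR : R ⊆ Icc (-(B : ℝ)) B ×ˢ Icc (-(B : ℝ)) B) {X : ℝ}
    (hX : ∀ S : Finset (ℤ × ℤ), (0 : ℤ × ℤ) ∉ S →
      ∑ n ∈ S, ‖∫ x in R, character n x‖ ^ 2 ≤ X) :
    MeanSquareDiscrepancyLE R X := by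
  set A : ℝ := volume.real R with hA
  set G : ℝ × ℝ → ℝ := boxCount B R with hG
  have hGm : Measurable G := measurable_boxCount hRm
  have hGb : ∀ x, |G x| ≤
      (Finset.Icc (-(B : ℤ) - 1) (B + 1) ×ˢ Finset.Icc (-(B : ℤ) - 1) (B + 1)).card := fun x => by
    rw [abs_of_nonneg (boxCount_nonneg x)]; exact boxCount_le x
  have hvol : volume unitSquare = 1 := by
    rw [unitSquare, Measure.volume_eq_prod, Measure.prod_prod]; simp
  have hcell : (Icc (0 : ℝ) 1 ×ˢ Icc (0 : ℝ) 1 : Set (ℝ × ℝ)) =ᵐ[volume] unitSquare := by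
    rw [Measure.volume_eq_prod]
    exact Measure.set_prod_ae_eq Ioc_ae_eq_Icc.symm Ioc_ae_eq_Icc.symm
  have hIcc : MeasurableSet (Icc (0 : ℝ) 1 ×ˢ Icc (0 : ℝ) 1 : Set (ℝ × ℝ)) :=
    measurableSet_Icc.prod measurableSet_Icc
  have heq : EqOn (fun ω : ℝ × ℝ => |discrepancy (shiftedLattice ω) R| ^ 2)
      (fun ω => (G ω - A) ^ 2) (Icc (0 : ℝ) 1 ×ˢ Icc (0 : ℝ) 1) := by
    intro ω hω
    simp only [discrepancy, sq_abs, ncard_shiftedLattice_inter hR hω, hA, hG]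
  have hfinm : IsFiniteMeasure (volume.restrict unitSquare) :=
    ⟨by rw [Measure.restrict_apply_univ, hvol]; exact ENNReal.one_lt_top⟩
  have hGi : IntegrableOn G unitSquare :=
    Integrable.of_bound hGm.aestronglyMeasurable _ (Filter.Eventually.of_forall hGb)
  have hG2i : IntegrableOn (fun ω => G ω ^ 2) unitSquare := by
    refine Integrable.of_bound (hGm.pow_const 2).aestronglyMeasurable
      (((Finset.Icc (-(B : ℤ) - 1) (B + 1) ×ˢ
        Finset.Icc (-(B : ℤ) - 1) (B + 1)).card : ℝ) ^ 2)
      (Filter.Eventually.of_forall fun x => ?_)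
    rw [Real.norm_eq_abs, abs_pow]
    exact pow_le_pow_left₀ (abs_nonneg _) (hGb x) 2
  have hconst : IntegrableOn (fun _ : ℝ × ℝ => A ^ 2) unitSquare := integrable_const _
  have hexp : (fun ω => (G ω - A) ^ 2) = fun ω => G ω ^ 2 - 2 * A * G ω + A ^ 2 := by
    ext ω; ring
  have hlin : IntegrableOn (fun ω => 2 * A * G ω) unitSquare := hGi.const_mul _
  have hquad : IntegrableOn (fun ω => G ω ^ 2 - 2 * A * G ω) unitSquare := hG2i.sub hlin
  have hDi : IntegrableOn (fun ω => (G ω - A) ^ 2) unitSquare := by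
    rw [hexp]
    exact hquad.add hconst
  -- The coefficient at frequency `0`: the mean count is the area, so the mean square discrepancy is
  -- a variance.
  have hmean : ∫ ω in unitSquare, G ω = A := by
    have h0 := fourier_boxCount hRm hR 0
    simp only [character_zero, one_mul] at h0
    rw [integral_complex_ofReal, setIntegral_const] at h0
    rw [← Complex.ofReal_inj, hG, h0, hA]
    simp
  have hpars := hasSum_sq_fourier (fun ω => (G ω : ℂ)) (Complex.measurable_ofReal.comp hGm) _
    (fun x => by rw [Complex.norm_real]; exact hGb x)
  simp only [hG, fourier_boxCount hRm hR] at hpars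
  simp only [← hG, Complex.norm_real, Real.norm_eq_abs, sq_abs] at hpars
  have hzero : ‖∫ x in R, character 0 x‖ ^ 2 = A ^ 2 := by
    simp only [character_zero, setIntegral_const]
    simp [hA]
  have hvar : ∫ ω in unitSquare, (G ω - A) ^ 2 = (∫ ω in unitSquare, G ω ^ 2) - A ^ 2 := by
    rw [hexp, integral_add hquad hconst, integral_sub hG2i hlin, integral_const_mul, hmean, setIntegral_const]
    simp only [measureReal_def, hvol, ENNReal.toReal_one, smul_eq_mul]
    ring
  constructor
  · rw [integrableOn_congr_fun heq hIcc]
    exact hDi.congr_set_ae hcell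
  · rw [setIntegral_congr_fun hIcc heq, setIntegral_congr_set hcell, hvar]
    rw [sub_le_iff_le_add]
    refine hasSum_le_of_sum_le hpars fun S => ?_
    -- Frequency `0` contributes exactly the `A ^ 2` subtracted in the variance; the hypothesis
    -- bounds all the others.
    calc ∑ n ∈ S, ‖∫ x in R, character n x‖ ^ 2
        ≤ ∑ n ∈ insert 0 (S.erase 0), ‖∫ x in R, character n x‖ ^ 2 := by
          refine Finset.sum_le_sum_of_subset_of_nonneg ?_ fun _ _ _ => by positivity
          exact Finset.subset_insert_iff.mpr subset_rfl
      _ ≤ X + A ^ 2 := by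
          rw [Finset.sum_insert (Finset.notMem_erase _ _), hzero, add_comm]
          gcongr
          exact hX _ (Finset.notMem_erase _ _)

/-! ### Fourier transforms of rectangles -/

/-- The rotation by `φ` followed by the translation by `c`. -/
def rigidMap (φ : ℝ) (c : ℝ × ℝ) (y : ℝ × ℝ) : ℝ × ℝ :=
  (c.1 + y.1 * Real.cos φ - y.2 * Real.sin φ, c.2 + y.1 * Real.sin φ + y.2 * Real.cos φ)

theorem rectangle_eq_image (φ : ℝ) (c : ℝ × ℝ) (a b : ℝ) :
    rectangle φ c a b = rigidMap φ c '' (Icc 0 a ×ˢ Icc 0 b) := by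
  ext x
  constructor
  · rintro ⟨s, hs, t, ht, rfl⟩
    exact ⟨(s, t), ⟨hs, ht⟩, rfl⟩
  · rintro ⟨⟨s, t⟩, ⟨hs, ht⟩, rfl⟩
    exact ⟨s, hs, t, ht, rfl⟩

theorem continuous_rigidMap (φ : ℝ) (c : ℝ × ℝ) : Continuous (rigidMap φ c) := by
  unfold rigidMap; fun_prop

theorem dist_sq_rigidMap (φ : ℝ) (c y z : ℝ × ℝ) :
    ((rigidMap φ c y).1 - (rigidMap φ c z).1) ^ 2 + ((rigidMap φ c y).2 - (rigidMap φ c z).2) ^ 2 =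
      (y.1 - z.1) ^ 2 + (y.2 - z.2) ^ 2 := by
  simp only [rigidMap]
  linear_combination ((y.1 - z.1) ^ 2 + (y.2 - z.2) ^ 2) * Real.sin_sq_add_cos_sq φ

theorem injective_rigidMap (φ : ℝ) (c : ℝ × ℝ) : Function.Injective (rigidMap φ c) := by
  intro y z h
  have h2 := dist_sq_rigidMap φ c y z
  rw [h] at h2
  simp only [sub_self] at h2
  refine Prod.ext ?_ ?_ <;> nlinarith [sq_nonneg (y.1 - z.1), sq_nonneg (y.2 - z.2)]

theorem measurePreserving_rigidMap (φ : ℝ) (c : ℝ × ℝ) :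
    MeasurePreserving (rigidMap φ c) volume volume := by
  set f : (ℝ × ℝ) →ₗ[ℝ] (ℝ × ℝ) := Matrix.toLin (Module.Basis.finTwoProd ℝ)
    (Module.Basis.finTwoProd ℝ) !![Real.cos φ, -Real.sin φ; Real.sin φ, Real.cos φ] with hf
  have hdet : LinearMap.det f = 1 := by
    rw [hf, LinearMap.det_toLin, Matrix.det_fin_two_of]
    linear_combination Real.sin_sq_add_cos_sq φ
  have hmp : MeasurePreserving f volume volume := by
    refine ⟨f.continuous_of_finiteDimensional.measurable, ?_⟩
    rw [Measure.map_linearMap_addHaar_eq_smul_addHaar _ (by rw [hdet]; exact one_ne_zero), hdet]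
    simp
  have h2 := (measurePreserving_add_right (volume : Measure (ℝ × ℝ)) c).comp hmp
  convert h2 using 1
  ext y
  · simp only [rigidMap, Function.comp, hf, Matrix.toLin_finTwoProd_apply, Prod.fst_add]; ring
  · simp only [rigidMap, Function.comp, hf, Matrix.toLin_finTwoProd_apply, Prod.snd_add]; ring

theorem measurableSet_rectangle (φ : ℝ) (c : ℝ × ℝ) (a b : ℝ) :
    MeasurableSet (rectangle φ c a b) := by
  rw [rectangle_eq_image]
  exact ((isCompact_Icc.prod isCompact_Icc).image (continuous_rigidMap φ c)).measurableSet

theorem exists_box_rectangle (φ : ℝ) (c : ℝ × ℝ) (a b : ℝ) :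
    ∃ B : ℕ, rectangle φ c a b ⊆ Icc (-(B : ℝ)) B ×ˢ Icc (-(B : ℝ)) B := by
  have hc : IsCompact (rectangle φ c a b) := by
    rw [rectangle_eq_image]
    exact (isCompact_Icc.prod isCompact_Icc).image (continuous_rigidMap φ c)
  obtain ⟨r, hr⟩ := hc.isBounded.subset_closedBall (0 : ℝ × ℝ)
  obtain ⟨B, hB⟩ := exists_nat_ge r
  refine ⟨B, fun x hx => ?_⟩
  have h1 := hr hx
  rw [Metric.mem_closedBall, dist_zero_right, Prod.norm_def, max_le_iff, Real.norm_eq_abs,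
    Real.norm_eq_abs, abs_le, abs_le] at h1
  refine ⟨⟨?_, ?_⟩, ?_, ?_⟩ <;> linarith [h1.1.1, h1.1.2, h1.2.1, h1.2.2]

/-- One-dimensional exponential integral over `[0, a]` with frequency `ξ`. -/
def expIntegral (a ξ : ℝ) : ℂ :=
  ∫ s in Icc 0 a, Complex.exp (-(2 * Real.pi * Complex.I * (s * ξ)))

theorem norm_expIntegral_le {a : ℝ} (ha : 0 ≤ a) (ξ : ℝ) : ‖expIntegral a ξ‖ ≤ a := by
  unfold expIntegral
  have := norm_setIntegral_le_of_norm_le_const (μ := volume) (s := Icc 0 a) (C := 1)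
    (f := fun s : ℝ => Complex.exp (-(2 * Real.pi * Complex.I * (s * ξ)))) (by simp) (by
      intro x _
      rw [show -(2 * (Real.pi : ℂ) * Complex.I * (x * ξ)) =
        ((-(2 * Real.pi * (x * ξ)) : ℝ) : ℂ) * Complex.I by push_cast; ring,
        Complex.norm_exp_ofReal_mul_I])
  simpa [measureReal_def, ha] using this

theorem norm_expIntegral_le_inv {a : ℝ} (ha : 0 ≤ a) {ξ : ℝ} (hξ : ξ ≠ 0) :
    ‖expIntegral a ξ‖ ≤ |ξ|⁻¹ := by
  unfold expIntegral
  rw [integral_Icc_eq_integral_Ioc, ← intervalIntegral.integral_of_le ha]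
  set w : ℂ := -(2 * Real.pi * Complex.I * ξ) with hw
  have hw0 : w ≠ 0 := by
    simp [hw, hξ, Real.pi_ne_zero]
  have hfun : (fun s : ℝ => Complex.exp (-(2 * Real.pi * Complex.I * (s * ξ)))) =
      fun s : ℝ => Complex.exp (w * s) := by
    ext s; congr 1; rw [hw]; ring
  rw [hfun, integral_exp_mul_complex hw0]
  have hn : ‖w‖ = 2 * Real.pi * |ξ| := by
    simp [hw, abs_of_pos Real.pi_pos]
  have hexp : ∀ s : ℝ, ‖Complex.exp (w * s)‖ = 1 := by
    intro s
    rw [show w * s = ((-(2 * Real.pi * (s * ξ)) : ℝ) : ℂ) * Complex.I by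
      rw [hw]; push_cast; ring, Complex.norm_exp_ofReal_mul_I]
  have hnum : ‖Complex.exp (w * a) - Complex.exp (w * (0 : ℝ))‖ ≤ 2 := by
    refine (norm_sub_le _ _).trans ?_
    rw [hexp, hexp]; norm_num
  rw [norm_div, hn]
  have hpos : 0 < |ξ| := abs_pos.mpr hξ
  have hpi := Real.pi_gt_three
  rw [div_le_iff₀ (by positivity)]
  have : |ξ|⁻¹ * (2 * Real.pi * |ξ|) = 2 * Real.pi := by field_simp
  rw [this]
  linarith

/-- The Fourier transform of a rectangle is a product of one-dimensional integrals. -/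
theorem norm_integral_rectangle (φ : ℝ) (c : ℝ × ℝ) (a b : ℝ) (n : ℤ × ℤ) :
    ‖∫ x in rectangle φ c a b, character n x‖ =
      ‖expIntegral a (n.1 * Real.cos φ + n.2 * Real.sin φ)‖ *
        ‖expIntegral b (n.2 * Real.cos φ - n.1 * Real.sin φ)‖ := by
  rw [rectangle_eq_image, (measurePreserving_rigidMap φ c).setIntegral_image_emb
    ((continuous_rigidMap φ c).measurableEmbedding (injective_rigidMap φ c))]
  have hfun : ∀ y : ℝ × ℝ, character n (rigidMap φ c y) = character n c *
      (Complex.exp (-(2 * Real.pi * Complex.I *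
          (y.1 * ((n.1 * Real.cos φ + n.2 * Real.sin φ : ℝ) : ℂ)))) *
        Complex.exp (-(2 * Real.pi * Complex.I *
          (y.2 * ((n.2 * Real.cos φ - n.1 * Real.sin φ : ℝ) : ℂ))))) := by
    intro y
    simp only [character, rigidMap, ← Complex.exp_add]
    congr 1
    push_cast
    ring
  simp only [hfun]
  rw [integral_const_mul, norm_mul, norm_character, one_mul, Measure.volume_eq_prod,
    setIntegral_prod_mul (fun s : ℝ => Complex.exp (-(2 * Real.pi * Complex.I *
          (s * ((n.1 * Real.cos φ + n.2 * Real.sin φ : ℝ) : ℂ)))))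
      (fun t : ℝ => Complex.exp (-(2 * Real.pi * Complex.I *
          (t * ((n.2 * Real.cos φ - n.1 * Real.sin φ : ℝ) : ℂ))))), norm_mul]
  rfl

/-- Sides of a rectangle inside the big square are at most its diagonal. -/
theorem sides_le_of_subset_bigSquare {φ : ℝ} {c : ℝ × ℝ} {a b α : ℝ} {N : ℕ} (ha : 0 < a)
    (hb : 0 < b) (h : rectangle φ c a b ⊆ bigSquare α N) :
    a ≤ √(2 * N) ∧ b ≤ √(2 * N) := by
  -- Rigid maps preserve distances, so a side of `R` is a distance between two points of a square
  -- with squared diameter `2N`.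
  have diam : ∀ y ∈ Icc (0 : ℝ) a ×ˢ Icc (0 : ℝ) b, (y.1 - 0) ^ 2 + (y.2 - 0) ^ 2 ≤ 2 * (N : ℝ) := by
    intro y hy
    have h1 : rigidMap φ c y ∈ bigSquare α N := h (by rw [rectangle_eq_image]; exact ⟨y, hy, rfl⟩)
    have h2 : rigidMap φ c 0 ∈ bigSquare α N :=
      h (by rw [rectangle_eq_image]; exact ⟨0, ⟨⟨le_rfl, ha.le⟩, le_rfl, hb.le⟩, rfl⟩)
    have h3 := dist_sq_rigidMap φ c y 0
    rw [bigSquare, rectangle_eq_image] at h1 h2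
    obtain ⟨u, ⟨⟨hu1, hu2⟩, hu3, hu4⟩, hu⟩ := h1
    obtain ⟨v, ⟨⟨hv1, hv2⟩, hv3, hv4⟩, hv⟩ := h2
    rw [← hu, ← hv, dist_sq_rigidMap] at h3
    simp only [Prod.fst_zero, Prod.snd_zero] at h3
    have hN : √(N : ℝ) ^ 2 = N := Real.sq_sqrt (Nat.cast_nonneg N)
    rw [← h3, two_mul, ← hN]
    refine add_le_add ?_ ?_ <;> refine sq_le_sq.mpr ?_ <;>
      rw [abs_of_nonneg (Real.sqrt_nonneg _), abs_le] <;> constructor <;> linarith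
  constructor
  · have := diam (a, 0) ⟨⟨ha.le, le_rfl⟩, le_rfl, hb.le⟩
    exact Real.le_sqrt_of_sq_le (by simpa using this)
  · have := diam (0, b) ⟨⟨le_rfl, ha.le⟩, hb.le, le_rfl⟩
    exact Real.le_sqrt_of_sq_le (by simpa using this)

/-! ### Sums of truncated inverse squares over separated numbers -/

/-- The subtracted term makes the induction close: each summand is at most the difference of
consecutive values of `2 / (K + 1)`. -/
theorem sum_inv_sq_le (K : ℕ) : ∑ i ∈ Finset.range K, 1 / ((i : ℝ) + 1) ^ 2 ≤
    2 - 2 / ((K : ℝ) + 1) := by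
  induction K with
  | zero => simp
  | succ K ih =>
    rw [Finset.sum_range_succ]
    have h : 1 / ((K : ℝ) + 1) ^ 2 ≤ 2 / (K + 1) - 2 / (K + 1 + 1) := by
      rw [div_sub_div _ _ (by positivity) (by positivity), div_le_div_iff₀ (by positivity)
        (by positivity)]
      nlinarith [(Nat.cast_nonneg K : (0 : ℝ) ≤ K), sq_nonneg ((K : ℝ) + 1)]
    push_cast
    linarith

/-- A discrete integral comparison: `X² / (1 + X t)²`, which up to the factor `4` dominates `min
(X², 1/t²)`, is `X` times the derivative of `X t / (1 + X t)`. The increments on the right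
telescope, and their sum stays below `4 X / g` for any number of terms. -/
theorem min_sq_inv_sq_le {X g m : ℝ} (hX : 0 < X) (hg : 0 < g) (hm : 0 ≤ m) :
    min (X ^ 2) (1 / (g * (m + 1)) ^ 2) ≤
      4 * X / g * (X * g * (m + 1) / (1 + X * g * (m + 1)) - X * g * m / (1 + X * g * m)) := by
  have hy : 0 < X * g := mul_pos hX hg
  set y := X * g with hyd
  have h1 : y * (m + 1) / (1 + y * (m + 1)) - y * m / (1 + y * m) =
      y / ((1 + y * (m + 1)) * (1 + y * m)) := by
    field_simp; ring
  rw [h1]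
  have h2 : 4 * X / g * (y / ((1 + y * (m + 1)) * (1 + y * m))) =
      4 * X ^ 2 / ((1 + y * (m + 1)) * (1 + y * m)) := by
    rw [hyd]; field_simp
  rw [h2]
  have h3 : 4 * X ^ 2 / (1 + y * (m + 1)) ^ 2 ≤ 4 * X ^ 2 / ((1 + y * (m + 1)) * (1 + y * m)) := by
    apply div_le_div_of_nonneg_left (by positivity) (by positivity)
    rw [sq]
    apply mul_le_mul_of_nonneg_left _ (by positivity)
    nlinarith
  refine le_trans ?_ h3
  rcases le_total (y * (m + 1)) 1 with h | h
  · refine (min_le_left _ _).trans ?_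
    rw [le_div_iff₀ (by positivity)]
    have : (1 + y * (m + 1)) ^ 2 ≤ 4 := by
      have h0 : 0 ≤ y * (m + 1) := by positivity
      nlinarith
    nlinarith [sq_nonneg X]
  · refine (min_le_right _ _).trans ?_
    rw [div_le_div_iff₀ (by positivity) (by positivity)]
    have e : 4 * X ^ 2 * (g * (m + 1)) ^ 2 = 4 * (y * (m + 1)) ^ 2 := by rw [hyd]; ring
    rw [e]
    nlinarith

theorem sum_min_le (X g : ℝ) (hX : 0 < X) (hg : 0 < g) (K : ℕ) :
    ∑ i ∈ Finset.range K, min (X ^ 2) (1 / (g * ((i : ℝ) + 1)) ^ 2) ≤ min (2 / g ^ 2) (4 * X / g) := by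
  refine le_min ?_ ?_
  · calc ∑ i ∈ Finset.range K, min (X ^ 2) (1 / (g * ((i : ℝ) + 1)) ^ 2)
        ≤ ∑ i ∈ Finset.range K, 1 / g ^ 2 * (1 / ((i : ℝ) + 1) ^ 2) :=
          Finset.sum_le_sum fun i _ => (min_le_right _ _).trans_eq (by rw [mul_pow]; field_simp)
      _ ≤ 1 / g ^ 2 * 2 := by
          rw [← Finset.mul_sum]
          gcongr
          exact (sum_inv_sq_le K).trans (sub_le_self _ (by positivity))
      _ = 2 / g ^ 2 := by ring
  · have hy : 0 < X * g := mul_pos hX hg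
    calc ∑ i ∈ Finset.range K, min (X ^ 2) (1 / (g * ((i : ℝ) + 1)) ^ 2)
        ≤ ∑ i ∈ Finset.range K, 4 * X / g * (X * g * ((i + 1 : ℕ) : ℝ) /
            (1 + X * g * ((i + 1 : ℕ) : ℝ)) - X * g * i / (1 + X * g * i)) := by
          refine Finset.sum_le_sum fun i _ => ?_
          push_cast
          exact min_sq_inv_sq_le hX hg (Nat.cast_nonneg i)
      _ = 4 * X / g * (X * g * K / (1 + X * g * K)) := by
          rw [← Finset.mul_sum,
            Finset.sum_range_sub (fun i : ℕ => X * g * (i : ℝ) / (1 + X * g * i))]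
          simp
      _ ≤ 4 * X / g * 1 := by
          gcongr
          rw [div_le_one (by positivity)]
          linarith
      _ = 4 * X / g := mul_one _

/-- Rounding `f` down to a multiple of `g` is injective by separation, so the sum is dominated by
the one over the progression `g, 2g, 3g, …`. -/
theorem sum_min_le_of_separated_pos {ι : Type*} (S : Finset ι) (f : ι → ℝ) {X g : ℝ} (hX : 0 < X)
    (hg : 0 < g) (h1 : ∀ x ∈ S, g ≤ f x)
    (h2 : ∀ x ∈ S, ∀ y ∈ S, x ≠ y → g ≤ |f x - f y|) :
    ∑ x ∈ S, min (X ^ 2) (1 / f x ^ 2) ≤ min (2 / g ^ 2) (4 * X / g) := by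
  set m : ι → ℕ := fun x => ⌊f x / g⌋₊ - 1 with hm
  have hfl : ∀ x ∈ S, ((m x : ℝ) + 1) * g ≤ f x ∧ f x < ((m x : ℝ) + 2) * g := by
    intro x hx
    have hge : 1 ≤ f x / g := (one_le_div hg).mpr (h1 x hx)
    have hf1 : 1 ≤ ⌊f x / g⌋₊ := (Nat.one_le_floor_iff _).mpr hge
    have hm1 : ((m x : ℝ) + 1) = (⌊f x / g⌋₊ : ℝ) := by
      rw [hm]; push_cast [Nat.cast_sub hf1]; ring
    constructor
    · rw [hm1, ← le_div_iff₀ hg]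
      exact Nat.floor_le (by linarith)
    · rw [show (m x : ℝ) + 2 = (⌊f x / g⌋₊ : ℝ) + 1 by linarith, ← div_lt_iff₀ hg]
      exact Nat.lt_floor_add_one _
  have hinj : Set.InjOn m S := by
    intro x hx y hy hxy
    by_contra hne
    have h3 := h2 x hx y hy hne
    have h4 := hfl x hx
    have h5 := hfl y hy
    rw [hxy] at h4
    have h6 : |f x - f y| < g := by
      rw [abs_lt]; constructor <;> nlinarith [h4.1, h4.2, h5.1, h5.2]
    linarith
  obtain ⟨K, hK⟩ := (S.image m).exists_nat_subset_range
  calc ∑ x ∈ S, min (X ^ 2) (1 / f x ^ 2)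
      ≤ ∑ x ∈ S, min (X ^ 2) (1 / (g * ((m x : ℝ) + 1)) ^ 2) := by
        refine Finset.sum_le_sum fun x hx => min_le_min_left _ ?_
        have := (hfl x hx).1
        refine one_div_le_one_div_of_le (by positivity) ?_
        refine pow_le_pow_left₀ (by positivity) (by linarith) 2
    _ = ∑ i ∈ S.image m, min (X ^ 2) (1 / (g * ((i : ℝ) + 1)) ^ 2) :=
        (Finset.sum_image (f := fun i : ℕ => min (X ^ 2) (1 / (g * ((i : ℝ) + 1)) ^ 2)) hinj).symm
    _ ≤ ∑ i ∈ Finset.range K, min (X ^ 2) (1 / (g * ((i : ℝ) + 1)) ^ 2) :=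
        Finset.sum_le_sum_of_subset_of_nonneg hK fun _ _ _ => by positivity
    _ ≤ _ := sum_min_le X g hX hg K

/-- Sums of truncated inverse squares of separated nonzero numbers. -/
theorem sum_min_le_of_separated {ι : Type*} (S : Finset ι) (f : ι → ℝ) {X g : ℝ} (hX : 0 < X)
    (hg : 0 < g) (h1 : ∀ x ∈ S, g ≤ |f x|)
    (h2 : ∀ x ∈ S, ∀ y ∈ S, x ≠ y → g ≤ |f x - f y|) :
    ∑ x ∈ S, min (X ^ 2) (1 / f x ^ 2) ≤ 2 * min (2 / g ^ 2) (4 * X / g) := by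
  rw [← Finset.sum_filter_add_sum_filter_not S (fun x => 0 < f x), two_mul]
  refine add_le_add ?_ ?_
  · refine sum_min_le_of_separated_pos _ f hX hg ?_ ?_
    · intro x hx
      rw [Finset.mem_filter] at hx
      simpa [abs_of_pos hx.2] using h1 x hx.1
    · intro x hx y hy
      exact h2 x (Finset.mem_of_mem_filter x hx) y (Finset.mem_of_mem_filter y hy)
  · simp only [← neg_sq (f _)]
    refine sum_min_le_of_separated_pos _ (fun x => -f x) hX hg ?_ ?_
    · intro x hx
      rw [Finset.mem_filter, not_lt] at hx
      simpa [abs_of_nonpos hx.2] using h1 x hx.1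
    · intro x hx y hy hne
      rw [neg_sub_neg, abs_sub_comm]
      exact h2 x (Finset.mem_of_mem_filter x hx) y (Finset.mem_of_mem_filter y hy) hne

/-! ### Linear forms on dyadic shells -/

/-- The linear form `⟨n, (cos φ, sin φ)⟩`. -/
def linForm (φ : ℝ) (n : ℤ × ℤ) : ℝ := n.1 * Real.cos φ + n.2 * Real.sin φ

/-- The linear form in direction `φ` is at least `g k` on nonzero integer vectors of size at most
`2 ^ k`. -/
def LinFormBound (φ : ℝ) (g : ℕ → ℝ) : Prop :=
  ∀ (k : ℕ) (n : ℤ × ℤ), n ≠ 0 → |(n.1 : ℝ)| ≤ 2 ^ k → |(n.2 : ℝ)| ≤ 2 ^ k → g k ≤ |linForm φ n|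

/-- The dyadic size of an integer vector. -/
def dyadicSize (n : ℤ × ℤ) : ℕ := Nat.log 2 (max n.1.natAbs n.2.natAbs)

theorem abs_le_of_dyadicSize (n : ℤ × ℤ) :
    |(n.1 : ℝ)| ≤ 2 ^ (dyadicSize n + 1) ∧ |(n.2 : ℝ)| ≤ 2 ^ (dyadicSize n + 1) := by
  have h := (Nat.lt_pow_succ_log_self (b := 2) (by norm_num) (max n.1.natAbs n.2.natAbs)).le
  rw [max_le_iff] at h
  constructor
  · have : ((n.1.natAbs : ℕ) : ℝ) ≤ ((2 ^ (dyadicSize n + 1) : ℕ) : ℝ) := Nat.cast_le.mpr h.1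
    rw [Nat.cast_natAbs] at this
    exact_mod_cast this
  · have : ((n.2.natAbs : ℕ) : ℝ) ≤ ((2 ^ (dyadicSize n + 1) : ℕ) : ℝ) := Nat.cast_le.mpr h.2
    rw [Nat.cast_natAbs] at this
    exact_mod_cast this

theorem pow_dyadicSize_le {n : ℤ × ℤ} (hn : n ≠ 0) :
    (4 : ℝ) ^ dyadicSize n ≤ (n.1 : ℝ) ^ 2 + (n.2 : ℝ) ^ 2 := by
  have hmax : max n.1.natAbs n.2.natAbs ≠ 0 := by
    intro h
    apply hn
    refine Prod.ext ?_ ?_ <;> simp <;> omega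
  have h := Nat.pow_log_le_self 2 hmax
  have h' : ((2 : ℝ) ^ dyadicSize n) ≤ max |(n.1 : ℝ)| |(n.2 : ℝ)| := by
    have : ((2 ^ dyadicSize n : ℕ) : ℝ) ≤ ((max n.1.natAbs n.2.natAbs : ℕ) : ℝ) := Nat.cast_le.mpr h
    push_cast [Nat.cast_natAbs] at this
    exact this
  rw [show (4 : ℝ) = 2 ^ 2 by norm_num, ← pow_mul, mul_comm, pow_mul]
  rcases le_max_iff.mp h' with h1 | h1
  · have := pow_le_pow_left₀ (by positivity) h1 2
    rw [sq_abs] at this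
    nlinarith [sq_nonneg (n.2 : ℝ)]
  · have := pow_le_pow_left₀ (by positivity) h1 2
    rw [sq_abs] at this
    nlinarith [sq_nonneg (n.1 : ℝ)]

theorem linForm_sq_add_sq (φ : ℝ) (n : ℤ × ℤ) :
    linForm φ n ^ 2 + linForm (φ + Real.pi / 2) n ^ 2 = (n.1 : ℝ) ^ 2 + (n.2 : ℝ) ^ 2 := by
  simp only [linForm, Real.cos_add_pi_div_two, Real.sin_add_pi_div_two]
  linear_combination ((n.1 : ℝ) ^ 2 + (n.2 : ℝ) ^ 2) * Real.sin_sq_add_cos_sq φ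

/-- The difference of two vectors of the shell is an integer vector with entries at most `2 ^ (k +
2)`. By linearity the lower bound for the form at that size is a separation bound for its values;
this accounts for the index `k + 2`. -/
theorem sum_linForm_le {φ : ℝ} {g : ℕ → ℝ} (hg : ∀ k, 0 < g k) (h : LinFormBound φ g) {X : ℝ}
    (hX : 0 < X) (k : ℕ) (S : Finset (ℤ × ℤ)) (hS : ∀ n ∈ S, n ≠ 0 ∧ dyadicSize n = k) :
    ∑ n ∈ S, min (X ^ 2) (1 / linForm φ n ^ 2) ≤
      2 * min (2 / g (k + 2) ^ 2) (4 * X / g (k + 2)) := by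
  have hp : (2 : ℝ) ^ (k + 1) ≤ 2 ^ (k + 2) := pow_le_pow_right₀ (by norm_num) (by omega)
  refine sum_min_le_of_separated S _ hX (hg _) ?_ ?_
  · intro n hn
    obtain ⟨h0, hk⟩ := hS n hn
    have h1 := abs_le_of_dyadicSize n
    rw [hk] at h1
    exact h _ n h0 (h1.1.trans hp) (h1.2.trans hp)
  · intro n hn n' hn' hne
    have h1 := abs_le_of_dyadicSize n
    have h2 := abs_le_of_dyadicSize n'
    rw [(hS n hn).2] at h1
    rw [(hS n' hn').2] at h2
    have e : linForm φ n - linForm φ n' = linForm φ (n - n') := by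
      simp only [linForm, Prod.fst_sub, Prod.snd_sub]
      push_cast
      ring
    have hd : (2 : ℝ) ^ (k + 2) = 2 ^ (k + 1) + 2 ^ (k + 1) := by ring
    rw [e]
    refine h _ _ (sub_ne_zero.mpr hne) ?_ ?_
    · rw [Prod.fst_sub, Int.cast_sub, hd]
      exact (abs_sub _ _).trans (add_le_add h1.1 h2.1)
    · rw [Prod.snd_sub, Int.cast_sub, hd]
      exact (abs_sub _ _).trans (add_le_add h1.2 h2.2)

theorem norm_expIntegral_sq_le {a X : ℝ} (ha : 0 ≤ a) (haX : a ≤ X) {ξ : ℝ} (hξ : ξ ≠ 0) :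
    ‖expIntegral a ξ‖ ^ 2 ≤ min (X ^ 2) (1 / ξ ^ 2) := by
  refine le_min ?_ ?_
  · exact pow_le_pow_left₀ (norm_nonneg _) ((norm_expIntegral_le ha ξ).trans haX) 2
  · have := pow_le_pow_left₀ (norm_nonneg _) (norm_expIntegral_le_inv ha hξ) 2
    rwa [inv_pow, sq_abs, ← one_div] at this

/-- One of the two squares is at least `D / 2`, so the corresponding factor is at most `2 / D`. -/
theorem mul_min_le {X ξ η D : ℝ} (hD : 0 < D) (h : D ≤ ξ ^ 2 + η ^ 2) :
    min (X ^ 2) (1 / ξ ^ 2) * min (X ^ 2) (1 / η ^ 2) ≤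
      2 / D * (min (X ^ 2) (1 / ξ ^ 2) + min (X ^ 2) (1 / η ^ 2)) := by
  have p1 : 0 ≤ min (X ^ 2) (1 / ξ ^ 2) := by positivity
  have p2 : 0 ≤ min (X ^ 2) (1 / η ^ 2) := by positivity
  have hD2 : 0 < 2 / D := by positivity
  have big : ∀ z : ℝ, D / 2 ≤ z ^ 2 → min (X ^ 2) (1 / z ^ 2) ≤ 2 / D := fun z hz => by
    refine (min_le_right _ _).trans ?_
    have := one_div_le_one_div_of_le (by positivity) hz
    rwa [one_div_div] at this
  rcases le_total (D / 2) (ξ ^ 2) with h1 | h1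
  · nlinarith [mul_le_mul_of_nonneg_right (big ξ h1) p2]
  · have h2 : D / 2 ≤ η ^ 2 := by linarith
    nlinarith [mul_le_mul_of_nonneg_left (big η h2) p1]

/-- Mean square discrepancy of a rectangle in terms of lower bounds for linear forms. -/
theorem meanSquareDiscrepancyLE_of_linFormBound {φ : ℝ} {c : ℝ × ℝ} {a b X Y : ℝ} {g : ℕ → ℝ}
    (ha : 0 < a) (hb : 0 < b) (haX : a ≤ X) (hbX : b ≤ X) (hg : ∀ k, 0 < g k)
    (h1 : LinFormBound φ g) (h2 : LinFormBound (φ + Real.pi / 2) g)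
    (hY : ∀ K : ℕ, ∑ k ∈ Finset.range K,
      8 / (4 : ℝ) ^ k * min (2 / g (k + 2) ^ 2) (4 * X / g (k + 2)) ≤ Y) :
    MeanSquareDiscrepancyLE (rectangle φ c a b) Y := by
  have hX : 0 < X := ha.trans_le haX
  obtain ⟨B, hB⟩ := exists_box_rectangle φ c a b
  refine meanSquareDiscrepancyLE_of_sum_le (measurableSet_rectangle φ c a b) hB fun S hS => ?_
  have hne : ∀ n ∈ S, n ≠ 0 := fun n hn h => hS (h ▸ hn)
  have hbound : ∀ n ∈ S, ‖∫ x in rectangle φ c a b, character n x‖ ^ 2 ≤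
      2 / 4 ^ dyadicSize n * (min (X ^ 2) (1 / linForm φ n ^ 2) +
        min (X ^ 2) (1 / linForm (φ + Real.pi / 2) n ^ 2)) := by
    intro n hn
    have hs := abs_le_of_dyadicSize n
    -- Needed because `1 / 0 = 0` would turn the truncated inverse square into `0` instead of `X ^
    -- 2`.
    have z1 : linForm φ n ≠ 0 :=
      abs_pos.mp ((hg _).trans_le (h1 _ n (hne n hn) hs.1 hs.2))
    have z2 : linForm (φ + Real.pi / 2) n ≠ 0 :=
      abs_pos.mp ((hg _).trans_le (h2 _ n (hne n hn) hs.1 hs.2))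
    have e2 : (n.2 : ℝ) * Real.cos φ - n.1 * Real.sin φ = linForm (φ + Real.pi / 2) n := by
      simp only [linForm, Real.cos_add_pi_div_two, Real.sin_add_pi_div_two]; ring
    rw [norm_integral_rectangle, mul_pow, e2]
    refine le_trans (mul_le_mul (norm_expIntegral_sq_le ha.le haX z1)
      (norm_expIntegral_sq_le hb.le hbX z2) (by positivity) (by positivity)) ?_
    refine mul_min_le (by positivity) ?_
    exact (linForm_sq_add_sq φ n).symm ▸ pow_dyadicSize_le (hne n hn)
  refine (Finset.sum_le_sum hbound).trans ?_
  obtain ⟨K, hK⟩ := (S.image dyadicSize).exists_nat_subset_range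
  rw [← Finset.sum_fiberwise_of_maps_to (g := dyadicSize) (t := Finset.range K)
    (fun n hn => hK (Finset.mem_image_of_mem _ hn))]
  refine (Finset.sum_le_sum fun k _ => ?_).trans (hY K)
  have hfib : ∀ n ∈ S.filter (fun n => dyadicSize n = k), n ≠ 0 ∧ dyadicSize n = k := by
    intro n hn
    rw [Finset.mem_filter] at hn
    exact ⟨hne n hn.1, hn.2⟩
  calc ∑ n ∈ S with dyadicSize n = k, 2 / 4 ^ dyadicSize n * (min (X ^ 2) (1 / linForm φ n ^ 2) +
        min (X ^ 2) (1 / linForm (φ + Real.pi / 2) n ^ 2))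
      = 2 / 4 ^ k * (∑ n ∈ S with dyadicSize n = k, min (X ^ 2) (1 / linForm φ n ^ 2) +
        ∑ n ∈ S with dyadicSize n = k, min (X ^ 2) (1 / linForm (φ + Real.pi / 2) n ^ 2)) := by
        rw [← Finset.sum_add_distrib, Finset.mul_sum]
        refine Finset.sum_congr rfl fun n hn => ?_
        rw [(hfib n hn).2]
    _ ≤ 2 / 4 ^ k * (2 * min (2 / g (k + 2) ^ 2) (4 * X / g (k + 2)) +
        2 * min (2 / g (k + 2) ^ 2) (4 * X / g (k + 2))) := by
        gcongr
        · exact sum_linForm_le hg h1 hX k _ hfib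
        · exact sum_linForm_le hg h2 hX k _ hfib
    _ = 8 / (4 : ℝ) ^ k * min (2 / g (k + 2) ^ 2) (4 * X / g (k + 2)) := by ring

/-! ### From rational approximation of tangents to linear forms -/

/-- Lower bounds `ψ q` for the distance of `tan φ` to fractions with denominator `q`. -/
def TanBound (φ : ℝ) (ψ : ℕ → ℝ) : Prop :=
  ∀ (p : ℤ) (q : ℕ), 1 ≤ q → ψ q < |Real.tan φ - (p : ℝ) / (q : ℝ)|

theorem TanBound.neg {φ : ℝ} {ψ : ℕ → ℝ} (h : TanBound φ ψ) : TanBound (-φ) ψ := by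
  intro p q hq
  have := h (-p) q hq
  rw [Real.tan_neg, ← abs_neg]
  convert this using 2
  push_cast
  ring

theorem TanBound.add_pi {φ : ℝ} {ψ : ℕ → ℝ} (h : TanBound φ ψ) : TanBound (φ + Real.pi) ψ := by
  intro p q hq
  rw [Real.tan_add_pi]
  exact h p q hq

/-- Combines `c |cos x| < |sin x|` with `1 ≤ |sin x| + |cos x|`. A zero of the cosine is excluded by
`h`, since `Real.tan` takes the value `0` there. -/
theorem le_abs_sin_of_lt_abs_tan {c x : ℝ} (hc : 0 < c) (h : c < |Real.tan x|) :
    c / (1 + c) ≤ |Real.sin x| := by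
  have hcos : Real.cos x ≠ 0 := by
    intro h0
    rw [Real.tan_eq_sin_div_cos, h0, div_zero, abs_zero] at h
    linarith
  rw [Real.tan_eq_sin_div_cos, abs_div, lt_div_iff₀ (abs_pos.mpr hcos)] at h
  rw [div_le_iff₀ (by positivity)]
  have h1 := Real.abs_sin_le_one x
  have h2 : 1 ≤ |Real.sin x| + |Real.cos x| := by
    have h3 := Real.sin_sq_add_cos_sq x
    rw [← sq_abs, ← sq_abs (Real.cos x)] at h3
    nlinarith [abs_nonneg (Real.sin x), abs_nonneg (Real.cos x)]
  nlinarith [abs_nonneg (Real.sin x), abs_nonneg (Real.cos x)]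

theorem TanBound.linFormBound {φ κ : ℝ} {ψ g : ℕ → ℝ} (h : TanBound φ ψ)
    (hκ : κ ≤ |Real.cos φ|) (hκ0 : 0 < κ) (hψ : ∀ q, 1 ≤ q → 0 ≤ ψ q) (hg1 : ∀ k, g k ≤ κ)
    (hg : ∀ k q : ℕ, 1 ≤ q → (q : ℝ) ≤ 2 ^ k → g k ≤ κ * (q * ψ q)) : LinFormBound φ g := by
  intro k n hn h1 h2
  have hcos : Real.cos φ ≠ 0 := abs_pos.mp (hκ0.trans_le hκ)
  -- For `n.2 ≠ 0` the form factors as `cos φ · n.2 · (tan φ + n.1 / n.2)`, and `|n.2|` is the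
  -- denominator `q`. The case `n.2 = 0` has no fraction and needs only the bound for the cosine.
  by_cases hn2 : n.2 = 0
  · have hn1 : n.1 ≠ 0 := fun h0 => hn (Prod.ext h0 hn2)
    have : (1 : ℝ) ≤ |(n.1 : ℝ)| := by exact_mod_cast Int.one_le_abs hn1
    simp only [linForm, hn2, Int.cast_zero, zero_mul, add_zero, abs_mul]
    calc g k ≤ 1 * κ := by rw [one_mul]; exact hg1 k
      _ ≤ _ := mul_le_mul this hκ hκ0.le (abs_nonneg _)
  · have hq : 1 ≤ n.2.natAbs := Int.natAbs_pos.mpr hn2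
    have hqr : ((n.2.natAbs : ℕ) : ℝ) = |(n.2 : ℝ)| := by rw [Nat.cast_natAbs, Int.cast_abs]
    have hn2r : (n.2 : ℝ) ≠ 0 := Int.cast_ne_zero.mpr hn2
    have hfrac : ∃ p : ℤ, (p : ℝ) / (n.2.natAbs : ℝ) = -((n.1 : ℝ) / n.2) := by
      rw [hqr]
      rcases abs_choice (n.2 : ℝ) with h' | h'
      · refine ⟨-n.1, ?_⟩
        rw [h']; push_cast; ring
      · refine ⟨n.1, ?_⟩
        rw [h', div_neg]
    obtain ⟨p, hp⟩ := hfrac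
    have hb := h p _ hq
    rw [hp, sub_neg_eq_add] at hb
    have e : linForm φ n = Real.cos φ * (n.2 * (Real.tan φ + n.1 / n.2)) := by
      rw [linForm, Real.tan_eq_sin_div_cos]; field_simp; ring
    rw [e, abs_mul, abs_mul, ← hqr]
    refine (hg k _ hq (by rwa [hqr])).trans ?_
    refine mul_le_mul hκ ?_ (mul_nonneg (Nat.cast_nonneg _) (hψ _ hq)) (abs_nonneg _)
    exact mul_le_mul_of_nonneg_left hb.le (Nat.cast_nonneg _)

/-- This is why `directions` contains `0`, `π/2` and `Ω + π/2`: both side directions of a rectangle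
are of the form `±(α - θ)` with such a `θ`, up to adding `π`. -/
theorem tanBound_of_admissible {Ω : Set ℝ} {α φ : ℝ} {ψ : ℕ → ℝ}
    (h : ∀ θ ∈ directions Ω, TanBound (α - θ) ψ) (hφ : φ = α ∨ ∃ θ ∈ Ω, φ = θ - α) :
    TanBound φ ψ ∧ TanBound (φ + Real.pi / 2) ψ := by
  rcases hφ with rfl | ⟨θ, hθ, rfl⟩
  · constructor
    · simpa using h 0 (by simp [directions])
    · have := (h (Real.pi / 2) (by simp [directions])).add_pi
      convert this using 1
      ring
  · constructor
    · have := (h θ (by simp [directions, hθ])).neg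
      convert this using 1
      ring
    · have := (h (θ + Real.pi / 2) (by simp [directions, hθ])).neg
      convert this using 1
      ring

/-- Diophantine rotation angles give bounds for the mean square discrepancy. -/
theorem meanSquareDiscrepancyLE_of_tanBound {Ω : Set ℝ} {α c Y : ℝ} {ψ g : ℕ → ℝ} {N : ℕ}
    (hc : 0 < c) (hψ1 : ψ 1 = c) (h : ∀ θ ∈ directions Ω, TanBound (α - θ) ψ)
    (hψ : ∀ q, 1 ≤ q → 0 ≤ ψ q) (hg0 : ∀ k, 0 < g k) (hg1 : ∀ k, g k ≤ c / (1 + c))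
    (hg : ∀ k q : ℕ, 1 ≤ q → (q : ℝ) ≤ 2 ^ k → g k ≤ c / (1 + c) * (q * ψ q))
    (hY : ∀ K : ℕ, ∑ k ∈ Finset.range K,
      8 / (4 : ℝ) ^ k * min (2 / g (k + 2) ^ 2) (4 * √(2 * N) / g (k + 2)) ≤ Y)
    {R : Set (ℝ × ℝ)} (hR : R ∈ admissibleRectangles Ω α N) : MeanSquareDiscrepancyLE R Y := by
  obtain ⟨φ, o, a, b, hφ, ha, hb, rfl, hsub⟩ := hR
  obtain ⟨t1, t2⟩ := tanBound_of_admissible h hφ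
  obtain ⟨haX, hbX⟩ := sides_le_of_subset_bigSquare ha hb hsub
  have hκ0 : 0 < c / (1 + c) := by positivity
  -- The fraction `0 / 1` in the Diophantine condition bounds the tangents of both side directions
  -- below, hence both `|sin φ|` and `|cos φ|`.
  have s1 : c / (1 + c) ≤ |Real.sin φ| :=
    le_abs_sin_of_lt_abs_tan hc (by simpa [hψ1] using t1 0 1 le_rfl)
  have s2 : c / (1 + c) ≤ |Real.sin (φ + Real.pi / 2)| :=
    le_abs_sin_of_lt_abs_tan hc (by simpa [hψ1] using t2 0 1 le_rfl)
  rw [Real.sin_add_pi_div_two] at s2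
  refine meanSquareDiscrepancyLE_of_linFormBound ha hb haX hbX hg0
    (t1.linFormBound s2 hκ0 hψ hg1 hg) (t2.linFormBound ?_ hκ0 hψ hg1 hg) hY
  rwa [Real.cos_add_pi_div_two, abs_neg]

/-! ### Discrepancy bounds for the two Diophantine conditions -/

theorem one_le_log2 (x : ℝ) : 1 ≤ log2 x := le_max_left _ _

theorem log2_le_of_le_two_pow {q : ℕ} (hq : 1 ≤ q) {k : ℕ} (h : (q : ℝ) ≤ 2 ^ k) :
    log2 q ≤ k + 1 := by
  refine max_le (by linarith [(Nat.cast_nonneg k : (0 : ℝ) ≤ k)]) ?_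
  have h1 : Real.logb 2 q ≤ k := by
    rw [Real.logb_le_iff_le_rpow (by norm_num) (by exact_mod_cast hq), Real.rpow_natCast]
    exact h
  linarith

theorem summable_pow_mul_geometric_shift (m : ℕ) {r : ℝ} (h0 : 0 < r) (h1 : r < 1) :
    Summable fun k : ℕ => ((k : ℝ) + 3) ^ m * r ^ k := by
  have h := summable_pow_mul_geometric_of_norm_lt_one m
    (r := r) (by rwa [Real.norm_of_nonneg h0.le])
  have h2 := ((summable_nat_add_iff 3).mpr h).mul_right (r ^ 3)⁻¹
  refine h2.congr fun k => ?_
  push_cast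
  rw [pow_add]
  field_simp

theorem sqrt_div_two_pow_le {N k : ℕ} (h : N ≤ 2 ^ k) : √(2 * (N : ℝ)) / 2 ^ k ≤ 2 * (√2)⁻¹ ^ k := by
  rw [div_le_iff₀ (by positivity), Real.sqrt_le_left (by positivity), mul_pow, mul_pow, ← pow_mul,
    mul_comm k 2, pow_mul, inv_pow, Real.sq_sqrt (by norm_num), ← pow_mul, mul_comm k 2, pow_mul]
  have h' : (N : ℝ) ≤ 2 ^ k := by exact_mod_cast h
  have e : (2 : ℝ) ^ 2 * (2⁻¹) ^ k * (2 ^ 2) ^ k = 4 * 2 ^ k := by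
    rw [show ((2 : ℝ) ^ 2) ^ k = 2 ^ k * 2 ^ k by rw [← mul_pow]; norm_num, inv_pow]
    field_simp
    norm_num
  rw [e]
  have : (0 : ℝ) ≤ N := Nat.cast_nonneg N
  linarith

theorem discrepancy_bound_of_isLogAngle {M : ℕ} {Ω : Set ℝ} {α : ℝ} (h : IsLogAngle M Ω α) :
    ∃ C : ℝ, ∀ N : ℕ, 1 ≤ N → ∀ R ∈ admissibleRectangles Ω α N,
      MeanSquareDiscrepancyLE R (C * log2 N ^ (4 * M + 1)) := by
  obtain ⟨c, hc, h⟩ := h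
  set κ := c / (1 + c) with hκ
  have hκ0 : 0 < κ := by positivity
  have hκc : κ ≤ c := div_le_self hc.le (by linarith)
  have hκ1 : κ ≤ 1 := (div_le_one (by positivity)).mpr (by linarith)
  have hr0 : (0 : ℝ) < (√2)⁻¹ := by positivity
  have hr1 : (√2)⁻¹ < (1 : ℝ) := by
    apply inv_lt_one_of_one_lt₀
    rw [Real.lt_sqrt (by norm_num)]; norm_num
  -- Majorant, free of `N`, for the shells with `2 ^ k ≥ N`: there `√(2N) / 2 ^ k` is at most `2
  -- (√2) ^ (-k)`.
  set T : ℕ → ℝ := fun k => 256 / κ ^ 2 * (((k : ℝ) + 3) ^ (2 * M) * (√2)⁻¹ ^ k) with hT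
  have hTs : Summable T := (summable_pow_mul_geometric_shift (2 * M) hr0 hr1).mul_left _
  have hT0 : ∀ k, 0 ≤ T k := fun k => by simp only [hT]; positivity
  refine ⟨256 / κ ^ 4 * (2 * 4 ^ (4 * M)) + ∑' k, T k, fun N hN R hR => ?_⟩
  set ψ : ℕ → ℝ := fun q => c / ((q : ℝ) ^ 2 * log2 q ^ (2 * M)) with hψ
  -- One `κ` is the lower bound for `|cos φ|`; the other replaces `c`, which is at least `κ`.
  set g : ℕ → ℝ := fun k => κ ^ 2 / (2 ^ k * ((k : ℝ) + 1) ^ (2 * M)) with hg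
  have hlog : ∀ x, 0 < log2 x := fun x => zero_lt_one.trans_le (one_le_log2 x)
  refine meanSquareDiscrepancyLE_of_tanBound (ψ := ψ) (g := g) hc ?_ (fun θ hθ => h θ hθ) ?_ ?_ ?_
    ?_ ?_ hR
  · simp [hψ, log2]
  · intro q _
    have := hlog q
    simp only [hψ]; positivity
  · intro k; simp only [hg]; positivity
  · intro k
    simp only [hg]
    have h1 : (1 : ℝ) ≤ 2 ^ k * ((k : ℝ) + 1) ^ (2 * M) :=
      one_le_mul_of_one_le_of_one_le (one_le_pow₀ (by norm_num))
        (one_le_pow₀ (by linarith [(Nat.cast_nonneg k : (0 : ℝ) ≤ k)]))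
    refine (div_le_self (by positivity) h1).trans ?_
    nlinarith
  · intro k q hq hqk
    have hq0 : (0 : ℝ) < q := by exact_mod_cast hq
    have hl := hlog q
    have e : κ * (q * ψ q) = κ * c / (q * log2 q ^ (2 * M)) := by
      simp only [hψ]; field_simp
    rw [← hκ, e]
    simp only [hg]
    apply div_le_div₀ (by positivity) (by nlinarith) (by positivity)
    have := log2_le_of_le_two_pow hq hqk
    gcongr
  · intro K
    -- Shells below `J` use the bound `2 / g²`, each giving at most a multiple of `(J + 2) ^ (4M)`;
    -- there are at most `J` of them, which is the extra logarithm. From `J` on `N ≤ 2 ^ k`, and the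
    -- bound `4 X / g` is used.
    set J := Nat.log 2 N + 1 with hJ
    have hNJ : N ≤ 2 ^ J := (Nat.lt_pow_succ_log_self (by norm_num) N).le
    have hterm : ∀ k ∈ Finset.range K,
        8 / (4 : ℝ) ^ k * min (2 / g (k + 2) ^ 2) (4 * √(2 * N) / g (k + 2)) ≤
          (if k < J then 256 / κ ^ 4 * ((J : ℝ) + 2) ^ (4 * M) else 0) + T k := by
      intro k _
      have h4 : (4 : ℝ) ^ k = 2 ^ k * 2 ^ k := by rw [← mul_pow]; norm_num
      have e3 : ((k + 2 : ℕ) : ℝ) + 1 = k + 3 := by push_cast; ring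
      split_ifs with hk
      · refine le_add_of_le_of_nonneg ?_ (hT0 k)
        have e : 8 / (4 : ℝ) ^ k * (2 / g (k + 2) ^ 2) =
            256 / κ ^ 4 * ((k : ℝ) + 3) ^ (4 * M) := by
          simp only [hg, e3, h4]
          rw [show 4 * M = (2 * M) * 2 by ring, pow_mul _ (2 * M) 2, pow_add]
          field_simp
          norm_num
        refine (mul_le_mul_of_nonneg_left (min_le_left _ _) (by positivity)).trans ?_
        rw [e]
        have : (k : ℝ) + 1 ≤ J := by exact_mod_cast hk
        exact mul_le_mul_of_nonneg_left
          (pow_le_pow_left₀ (by positivity) (by linarith) _) (by positivity)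
      · rw [zero_add]
        have hNk : N ≤ 2 ^ k := hNJ.trans (Nat.pow_le_pow_right (by norm_num) (not_lt.mp hk))
        have e : 8 / (4 : ℝ) ^ k * (4 * √(2 * N) / g (k + 2)) =
            128 / κ ^ 2 * ((k : ℝ) + 3) ^ (2 * M) * (√(2 * N) / 2 ^ k) := by
          simp only [hg, e3, h4]
          rw [pow_add]
          field_simp
          norm_num
        refine (mul_le_mul_of_nonneg_left (min_le_right _ _) (by positivity)).trans ?_
        rw [e]
        refine (mul_le_mul_of_nonneg_left (sqrt_div_two_pow_le hNk) (by positivity)).trans ?_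
        simp only [hT]
        apply le_of_eq
        ring
    refine (Finset.sum_le_sum hterm).trans ?_
    rw [Finset.sum_add_distrib, add_mul]
    have hL := one_le_log2 (N : ℝ)
    have hJL : (J : ℝ) ≤ log2 N + 1 := by
      have h1 : ((2 : ℝ) ^ (Nat.log 2 N)) ≤ N := by exact_mod_cast Nat.pow_log_le_self 2 (by omega)
      have h2 : (Nat.log 2 N : ℝ) ≤ Real.logb 2 N := by
        rw [Real.le_logb_iff_rpow_le (by norm_num) (by exact_mod_cast hN), Real.rpow_natCast]
        exact h1
      have h3 : Real.logb 2 N ≤ log2 N := le_max_right _ _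
      rw [hJ]; push_cast; linarith
    refine add_le_add ?_ ?_
    · calc ∑ k ∈ Finset.range K, (if k < J then 256 / κ ^ 4 * ((J : ℝ) + 2) ^ (4 * M) else 0)
          = ((Finset.range K).filter (· < J)).card * (256 / κ ^ 4 * ((J : ℝ) + 2) ^ (4 * M)) := by
            rw [← Finset.sum_filter, Finset.sum_const, nsmul_eq_mul]
        _ ≤ J * (256 / κ ^ 4 * ((J : ℝ) + 2) ^ (4 * M)) := by
            gcongr
            have hsub : (Finset.range K).filter (· < J) ⊆ Finset.range J := fun x hx => by
              rw [Finset.mem_filter] at hx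
              exact Finset.mem_range.mpr hx.2
            simpa using Finset.card_le_card hsub
        _ ≤ (2 * log2 N) * (256 / κ ^ 4 * (4 * log2 N) ^ (4 * M)) := by
            gcongr
            · linarith
            · linarith
        _ = 256 / κ ^ 4 * (2 * 4 ^ (4 * M)) * log2 N ^ (4 * M + 1) := by
            rw [mul_pow, pow_succ]; ring
    · calc ∑ k ∈ Finset.range K, T k ≤ ∑' k, T k := hTs.sum_le_tsum _ fun k _ => hT0 k
        _ ≤ (∑' k, T k) * log2 N ^ (4 * M + 1) :=
            le_mul_of_one_le_right (tsum_nonneg hT0) (one_le_pow₀ hL)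

theorem min_le_rpow_mul_rpow {x y l : ℝ} (hx : 0 < x) (hy : 0 < y) (h0 : 0 ≤ l) (h1 : l ≤ 1) :
    min x y ≤ x ^ l * y ^ (1 - l) := by
  have hm : 0 < min x y := lt_min hx hy
  calc min x y = (min x y) ^ l * (min x y) ^ (1 - l) := by
        rw [← Real.rpow_add hm, add_sub_cancel, Real.rpow_one]
    _ ≤ _ := mul_le_mul (Real.rpow_le_rpow hm.le (min_le_left _ _) h0)
        (Real.rpow_le_rpow hm.le (min_le_right _ _) (by linarith)) (by positivity) (by positivity)

theorem discrepancy_bound_of_isPowerAngle {d τ ε : ℝ} {Ω : Set ℝ} (hτ0 : 0 ≤ τ) (hτ1 : τ < 1)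
    (hτ : τ = 2 / (1 - d) ^ 2 - 2) (hε : 0 < ε) :
    ∃ η : ℝ, 0 < η ∧ ∀ α : ℝ, IsPowerAngle d η Ω α →
      ∃ C : ℝ, ∀ N : ℕ, 1 ≤ N → ∀ R ∈ admissibleRectangles Ω α N,
        MeanSquareDiscrepancyLE R (C * (N : ℝ) ^ (τ / (τ + 1) + ε)) := by
  -- The first bound keeps the final exponent within `ε`; the second ensures `β < 1` and `0 ≤ l`.
  set η := min (ε / 2) ((1 - τ) / 8) with hη
  have hη0 : 0 < η := lt_min (by linarith) (by linarith)
  have hηε : η ≤ ε / 2 := min_le_left _ _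
  have hητ : η ≤ (1 - τ) / 8 := min_le_right _ _
  refine ⟨η, hη0, ?_⟩
  rintro α ⟨c, hc, h⟩
  set β := τ + η with hβ
  have hβ0 : 0 < β := by linarith
  have hβ1 : β < 1 := by linarith
  -- Interpolation weight. With `P k = 2 ^ (k (1 + β))`, the mean of `P²` and `X P` is `P ^ (1 + l)
  -- X ^ (1 - l)`. At `(1 - β) / (1 + β)` the power of `P` is exactly `4 ^ k`; lowering `l` by `η`
  -- makes the series over `k` geometric.
  set l := (1 - β) / (1 + β) - η with hl
  have hl0 : 0 ≤ l := by
    rw [hl, sub_nonneg, le_div_iff₀ (by linarith)]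
    nlinarith
  have hl1 : l ≤ 1 := by
    have : (1 - β) / (1 + β) ≤ 1 := (div_le_one (by linarith)).mpr (by linarith)
    linarith
  have hlβ : (1 + β) * (1 + l) = 2 - η * (1 + β) := by
    rw [hl]
    have : 1 + β ≠ 0 := by linarith
    field_simp
    ring
  have hexp : (1 - l) / 2 ≤ τ / (τ + 1) + ε := by
    have e1 : (1 - l) / 2 = β / (1 + β) + η / 2 := by
      rw [hl]
      have : 1 + β ≠ 0 := by linarith
      field_simp
      ring
    have e2 : β / (1 + β) ≤ τ / (τ + 1) + η := by
      rw [div_le_iff₀ (by linarith)]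
      have : τ / (τ + 1) * (τ + 1) = τ := div_mul_cancel₀ _ (by linarith)
      have h3 : 0 ≤ τ / (τ + 1) := by positivity
      nlinarith
    linarith
  set κ := c / (1 + c) with hκ
  have hκ0 : 0 < κ := by positivity
  have hκc : κ ≤ c := div_le_self hc.le (by linarith)
  have hκ1 : κ ≤ 1 := (div_le_one (by positivity)).mpr (by linarith)
  set r : ℝ := (2 : ℝ) ^ (-η) with hr
  have hr0 : 0 < r := by positivity
  have hr1 : r < 1 := Real.rpow_lt_one_of_one_lt_of_neg (by norm_num) (by linarith)
  set A : ℝ := 4096 / κ ^ 4 with hA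
  have hA0 : 0 < A := by positivity
  refine ⟨A * 2 * ∑' k : ℕ, r ^ k, fun N hN R hR => ?_⟩
  have hN0 : (1 : ℝ) ≤ N := by exact_mod_cast hN
  set ψ : ℕ → ℝ := fun q => c * (q : ℝ) ^ (-(2 / (1 - d) ^ 2) - η) with hψ
  set P : ℕ → ℝ := fun k => ((2 : ℝ) ^ k) ^ (1 + β) with hP
  have hP0 : ∀ k, 0 < P k := fun k => by simp only [hP]; positivity
  have hP1 : ∀ k, 1 ≤ P k := fun k =>
    Real.one_le_rpow (one_le_pow₀ (by norm_num)) (by linarith)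
  set g : ℕ → ℝ := fun k => κ ^ 2 / P k with hg
  refine meanSquareDiscrepancyLE_of_tanBound (ψ := ψ) (g := g) hc ?_ (fun θ hθ => h θ hθ) ?_ ?_ ?_
    ?_ ?_ hR
  · simp [hψ]
  · intro q _
    simp only [hψ]; positivity
  · intro k
    have := hP0 k
    simp only [hg]; positivity
  · intro k
    simp only [hg]
    refine (div_le_self (by positivity) (hP1 k)).trans ?_
    nlinarith
  · intro k q hq hqk
    have hq0 : (0 : ℝ) < q := by exact_mod_cast hq
    have e : κ * (q * ψ q) = κ * c / (q : ℝ) ^ (1 + β) := by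
      simp only [hψ]
      -- Since `2 / (1 - d) ^ 2 = τ + 2`, the quantity `q ψ(q)` is `c q ^ (-(1 + β))`.
      rw [show -(2 / (1 - d) ^ 2) - η = -(1 + β) - 1 by rw [hβ, hτ]; ring, Real.rpow_sub_one hq0.ne',
        Real.rpow_neg hq0.le]
      field_simp
    rw [← hκ, e]
    simp only [hg]
    apply div_le_div₀ (by positivity) (by nlinarith) (by positivity)
    simp only [hP]
    gcongr
  · intro K
    set X := √(2 * (N : ℝ)) with hX
    have hX0 : 0 < X := by positivity
    have hXl : X ^ (1 - l) ≤ 2 * (N : ℝ) ^ (τ / (τ + 1) + ε) := by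
      rw [hX, Real.sqrt_eq_rpow, ← Real.rpow_mul (by positivity), Real.mul_rpow (by norm_num)
        (by positivity)]
      have h1 : 1 / 2 * (1 - l) ≤ τ / (τ + 1) + ε := by linarith
      have h2 : (2 : ℝ) ^ (1 / 2 * (1 - l)) ≤ 2 := by
        calc (2 : ℝ) ^ (1 / 2 * (1 - l)) ≤ (2 : ℝ) ^ (1 : ℝ) :=
              Real.rpow_le_rpow_of_exponent_le (by norm_num) (by linarith)
          _ = 2 := Real.rpow_one 2
      exact mul_le_mul h2 (Real.rpow_le_rpow_of_exponent_le hN0 h1) (by positivity) (by norm_num)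
    have hterm : ∀ k ∈ Finset.range K,
        8 / (4 : ℝ) ^ k * min (2 / g (k + 2) ^ 2) (4 * X / g (k + 2)) ≤
          A * (2 * (N : ℝ) ^ (τ / (τ + 1) + ε)) * r ^ k := by
      intro k _
      have hPk := hP0 k
      have hP2 : P (k + 2) ≤ 16 * P k := by
        simp only [hP]
        rw [pow_add, mul_comm, Real.mul_rpow (by norm_num) (by positivity)]
        gcongr
        calc ((2 : ℝ) ^ 2) ^ (1 + β) ≤ ((2 : ℝ) ^ 2) ^ (2 : ℝ) :=
              Real.rpow_le_rpow_of_exponent_le (by norm_num) (by linarith)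
          _ = 16 := by norm_num
      have m1 : 2 / g (k + 2) ^ 2 ≤ 512 / κ ^ 4 * P k ^ 2 := by
        have e : 2 / g (k + 2) ^ 2 = 2 / κ ^ 4 * P (k + 2) ^ 2 := by
          have := hP0 (k + 2)
          simp only [hg]; field_simp
        rw [e, show 512 / κ ^ 4 * P k ^ 2 = 2 / κ ^ 4 * (16 * P k) ^ 2 by ring]
        have := hP0 (k + 2)
        gcongr
      have m2 : 4 * X / g (k + 2) ≤ 512 / κ ^ 4 * (X * P k) := by
        have e : 4 * X / g (k + 2) = 4 / κ ^ 2 * (X * P (k + 2)) := by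
          have := hP0 (k + 2)
          simp only [hg]; field_simp
        rw [e]
        calc 4 / κ ^ 2 * (X * P (k + 2)) ≤ 4 / κ ^ 2 * (X * (16 * P k)) := by gcongr
          _ = 64 / κ ^ 2 * (X * P k) := by ring
          _ ≤ _ := by
            gcongr ?_ * _
            apply div_le_div₀ (by norm_num) (by norm_num) (by positivity)
            exact pow_le_pow_of_le_one hκ0.le hκ1 (by norm_num)
      have m3 : min (P k ^ 2) (X * P k) ≤ P k ^ (1 + l) * X ^ (1 - l) := by
        refine (min_le_rpow_mul_rpow (by positivity) (by positivity) hl0 hl1).trans_eq ?_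
        rw [Real.mul_rpow hX0.le hPk.le, ← Real.rpow_natCast, ← Real.rpow_mul hPk.le,
          mul_comm (X ^ (1 - l)), ← mul_assoc, ← Real.rpow_add hPk]
        congr 2
        push_cast
        ring
      have m4 : P k ^ (1 + l) ≤ 4 ^ k * r ^ k := by
        have e4 : (4 : ℝ) ^ k = ((2 : ℝ) ^ k) ^ (2 : ℝ) := by
          rw [Real.rpow_two, ← pow_mul, mul_comm, pow_mul]; norm_num
        have er : r ^ k = ((2 : ℝ) ^ k) ^ (-η) := by
          rw [hr, ← Real.rpow_natCast, ← Real.rpow_mul (by norm_num), ← Real.rpow_natCast 2 k,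
            ← Real.rpow_mul (by norm_num), mul_comm]
        have h2k : (0 : ℝ) < 2 ^ k := by positivity
        simp only [hP]
        rw [← Real.rpow_mul h2k.le, hlβ, e4, er, ← Real.rpow_add h2k]
        apply Real.rpow_le_rpow_of_exponent_le (one_le_pow₀ (by norm_num))
        nlinarith
      calc 8 / (4 : ℝ) ^ k * min (2 / g (k + 2) ^ 2) (4 * X / g (k + 2))
          ≤ 8 / (4 : ℝ) ^ k * min (512 / κ ^ 4 * P k ^ 2) (512 / κ ^ 4 * (X * P k)) := by
            gcongr
        _ = A / (4 : ℝ) ^ k * min (P k ^ 2) (X * P k) := by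
            rw [← mul_min_of_nonneg _ _ (by positivity), hA]; ring
        _ ≤ A / (4 : ℝ) ^ k * ((4 ^ k * r ^ k) * (2 * (N : ℝ) ^ (τ / (τ + 1) + ε))) := by
            gcongr
            refine m3.trans ?_
            gcongr
        _ = A * (2 * (N : ℝ) ^ (τ / (τ + 1) + ε)) * r ^ k := by
            field_simp
    refine (Finset.sum_le_sum hterm).trans ?_
    rw [← Finset.mul_sum]
    have hs := (summable_geometric_of_lt_one hr0.le hr1).sum_le_tsum (Finset.range K)
      (fun k _ => by positivity)
    calc A * (2 * (N : ℝ) ^ (τ / (τ + 1) + ε)) * ∑ k ∈ Finset.range K, r ^ k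
        ≤ A * (2 * (N : ℝ) ^ (τ / (τ + 1) + ε)) * ∑' k : ℕ, r ^ k := by gcongr
      _ = _ := by ring

/-! ### Covering numbers of lacunary sets -/

theorem IsLacunarySeq.ratio_pos {A p : ℝ} {ω : ℕ → ℝ} (h : IsLacunarySeq A p ω) : 0 < A := by
  have h0 := h 0
  have h1 : 0 < |ω 0 - p| := abs_pos.mpr (sub_ne_zero.mpr h0.1)
  have h2 : 0 < A * |ω 0 - p| := (abs_nonneg _).trans_lt h0.2
  exact pos_of_mul_pos_left h2 h1.le

theorem IsLacunarySeq.abs_sub_le {A p : ℝ} {ω : ℕ → ℝ} (h : IsLacunarySeq A p ω) (n : ℕ) :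
    |ω n - p| ≤ A ^ n * |ω 0 - p| := by
  induction n with
  | zero => simp
  | succ n ih =>
    calc |ω (n + 1) - p| ≤ A * |ω n - p| := (h n).2.le
      _ ≤ A * (A ^ n * |ω 0 - p|) := mul_le_mul_of_nonneg_left ih h.ratio_pos.le
      _ = _ := by ring

theorem IsLacunarySeq.abs_sub_le_first {A p : ℝ} {ω : ℕ → ℝ} (h : IsLacunarySeq A p ω) (hA : A < 1)
    (n : ℕ) : |ω n - p| ≤ |ω 0 - p| :=
  (h.abs_sub_le n).trans
    (mul_le_of_le_one_left (abs_nonneg _) (pow_le_one₀ h.ratio_pos.le hA.le))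

/-- Geometric decay, with an index depending only on `A`, `D` and `δ`. The uniformity over sequences
lets one `m` serve all limit points of a lacunary set. -/
theorem exists_tail_index {A : ℝ} (hA0 : 0 < A) (hA : A < 1) (D : ℝ) :
    ∃ C : ℝ, 0 ≤ C ∧ ∀ δ : ℝ, 0 < δ → δ ≤ 1 → ∃ m : ℕ, (m : ℝ) ≤ C * log2 (1 / δ) ∧
      ∀ (p : ℝ) (ω : ℕ → ℝ), IsLacunarySeq A p ω → |ω 0 - p| ≤ D → ∀ n, m ≤ n → |ω n - p| ≤ δ := by
  obtain ⟨j, hj⟩ := exists_pow_lt_of_lt_one (show (0 : ℝ) < 1 / 2 by norm_num) hA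
  obtain ⟨i, hi⟩ := pow_unbounded_of_one_lt D (show (1 : ℝ) < 2 by norm_num)
  refine ⟨j * (i + 2), by positivity, fun δ hδ hδ1 => ?_⟩
  set k := ⌈Real.logb 2 (1 / δ)⌉₊ with hk
  have hlog0 : 0 ≤ Real.logb 2 (1 / δ) :=
    Real.logb_nonneg (by norm_num) ((one_le_div hδ).mpr hδ1)
  have hk1 : (k : ℝ) ≤ 2 * log2 (1 / δ) := by
    have h1 := (Nat.ceil_lt_add_one hlog0).le
    have h2 : Real.logb 2 (1 / δ) ≤ log2 (1 / δ) := le_max_right _ _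
    have h3 := one_le_log2 (1 / δ)
    linarith
  have hk2 : (1 / 2 : ℝ) ^ k ≤ δ := by
    have h1 : 1 / δ ≤ (2 : ℝ) ^ k := by
      have := Nat.le_ceil (Real.logb 2 (1 / δ))
      rwa [Real.logb_le_iff_le_rpow (by norm_num) (by positivity), Real.rpow_natCast] at this
    rw [div_pow, one_pow]
    exact (one_div_le (by positivity) hδ).mpr h1
  refine ⟨j * (i + k), ?_, fun p ω hω hD n hn => ?_⟩
  · push_cast
    have h3 := one_le_log2 (1 / δ)
    have hi0 : (0 : ℝ) ≤ i := Nat.cast_nonneg i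
    rw [mul_assoc]
    refine mul_le_mul_of_nonneg_left ?_ (Nat.cast_nonneg j)
    nlinarith
  · calc |ω n - p| ≤ A ^ n * |ω 0 - p| := hω.abs_sub_le n
      _ ≤ A ^ (j * (i + k)) * 2 ^ i := by
        refine mul_le_mul (pow_le_pow_of_le_one hA0.le hA.le hn) (hD.trans hi.le)
          (abs_nonneg _) (by positivity)
      _ ≤ (1 / 2) ^ (i + k) * 2 ^ i := by
        rw [pow_mul]
        refine mul_le_mul_of_nonneg_right (pow_le_pow_left₀ (by positivity) hj.le _) (by positivity)
      _ = (1 / 2) ^ k := by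
        rw [pow_add, mul_right_comm, ← mul_pow]; norm_num
      _ ≤ δ := hk2

/-- `Ω` is covered by at most `n` intervals of length `δ`. -/
def HasCover (Ω : Set ℝ) (δ n : ℝ) : Prop :=
  ∃ t : Finset ℝ, (t.card : ℝ) ≤ n ∧ Ω ⊆ ⋃ c ∈ t, Icc c (c + δ)

/-- A finite set of left end points covering the terms of two sequences near their limit. -/
def seqCover (p δ : ℝ) (ω₁ ω₂ : ℕ → ℝ) (m : ℕ) : Finset ℝ :=
  {p - δ, p} ∪ ((Finset.range m).image ω₁ ∪ (Finset.range m).image ω₂)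

theorem card_seqCover_le (p δ : ℝ) (ω₁ ω₂ : ℕ → ℝ) (m : ℕ) :
    (seqCover p δ ω₁ ω₂ m).card ≤ 2 + (m + m) := by
  unfold seqCover
  refine (Finset.card_union_le _ _).trans (add_le_add Finset.card_le_two ?_)
  refine (Finset.card_union_le _ _).trans (add_le_add ?_ ?_) <;>
    exact Finset.card_image_le.trans (Finset.card_range m).le

theorem exists_mem_seqCover {p δ : ℝ} (hδ : 0 ≤ δ) {ω₁ ω₂ : ℕ → ℝ} {m : ℕ}
    (h1 : ∀ n, m ≤ n → |ω₁ n - p| ≤ δ) (h2 : ∀ n, m ≤ n → |ω₂ n - p| ≤ δ) {x : ℝ}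
    (hx : x ∈ range ω₁ ∪ range ω₂) : ∃ c ∈ seqCover p δ ω₁ ω₂ m, x ∈ Icc c (c + δ) := by
  have near : ∀ y, |y - p| ≤ δ → ∃ c ∈ seqCover p δ ω₁ ω₂ m, y ∈ Icc c (c + δ) := by
    intro y hy
    rw [abs_le] at hy
    rcases le_total y p with h | h
    · exact ⟨p - δ, by simp [seqCover], by linarith, by linarith⟩
    · exact ⟨p, by simp [seqCover], h, by linarith⟩
  rcases hx with ⟨n, rfl⟩ | ⟨n, rfl⟩
  · rcases le_or_gt m n with h | h
    · exact near _ (h1 n h)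
    · refine ⟨ω₁ n, ?_, le_rfl, by linarith⟩
      unfold seqCover
      exact Finset.mem_union_right _ (Finset.mem_union_left _
        (Finset.mem_image_of_mem _ (Finset.mem_range.mpr h)))
  · rcases le_or_gt m n with h | h
    · exact near _ (h2 n h)
    · refine ⟨ω₂ n, ?_, le_rfl, by linarith⟩
      unfold seqCover
      exact Finset.mem_union_right _ (Finset.mem_union_right _
        (Finset.mem_image_of_mem _ (Finset.mem_range.mpr h)))

/-- A term beyond `B` on the right must be attached to the maximum of `Ω`, since a larger point of
`Ω` would lie strictly between; likewise on the left with the minimum. So only the bounds at these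
at most two points matter, and the family is uniformly bounded. -/
theorem exists_bound_gap_terms {Ω : Set ℝ} {B : ℝ} (hB : ∀ p ∈ Ω, |p| ≤ B) (S : ℝ → Set ℝ)
    (hS : ∀ p ∈ Ω, ∃ b, ∀ x ∈ S p, |x| ≤ b)
    (hgap : ∀ p ∈ Ω, ∀ x ∈ S p, Disjoint Ω (uIoo p x)) :
    ∃ B', ∀ p ∈ Ω, ∀ x ∈ S p, |x| ≤ B' := by
  have upper : ∃ U, ∀ p ∈ Ω, ∀ x ∈ S p, x ≤ U := by
    have general : ∀ p ∈ Ω, ∀ x ∈ S p, (∃ p' ∈ Ω, p < p') → x ≤ B := by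
      rintro p hp x hx ⟨p', hp', hlt⟩
      by_contra hcon
      have hxp : p' < x := ((abs_le.mp (hB p' hp')).2).trans_lt (not_le.mp hcon)
      refine Set.disjoint_left.mp (hgap p hp x hx) hp' ?_
      rw [uIoo_of_lt (hlt.trans hxp)]
      exact ⟨hlt, hxp⟩
    by_cases h : ∃ m ∈ Ω, ∀ p ∈ Ω, p ≤ m
    · obtain ⟨m, hm, hmax⟩ := h
      obtain ⟨b, hb⟩ := hS m hm
      refine ⟨max B b, fun p hp x hx => ?_⟩
      rcases (hmax p hp).eq_or_lt with rfl | hlt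
      · exact (le_abs_self x).trans ((hb x hx).trans (le_max_right _ _))
      · exact (general p hp x hx ⟨m, hm, hlt⟩).trans (le_max_left _ _)
    · push Not at h
      exact ⟨B, fun p hp x hx => general p hp x hx (h p hp)⟩
  have lower : ∃ U, ∀ p ∈ Ω, ∀ x ∈ S p, -U ≤ x := by
    have general : ∀ p ∈ Ω, ∀ x ∈ S p, (∃ p' ∈ Ω, p' < p) → -B ≤ x := by
      rintro p hp x hx ⟨p', hp', hlt⟩
      by_contra hcon
      have hxp : x < p' := (not_le.mp hcon).trans_le ((abs_le.mp (hB p' hp')).1)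
      refine Set.disjoint_left.mp (hgap p hp x hx) hp' ?_
      rw [uIoo_of_gt (hxp.trans hlt)]
      exact ⟨hxp, hlt⟩
    by_cases h : ∃ m ∈ Ω, ∀ p ∈ Ω, m ≤ p
    · obtain ⟨m, hm, hmin⟩ := h
      obtain ⟨b, hb⟩ := hS m hm
      refine ⟨max B b, fun p hp x hx => ?_⟩
      rcases (hmin p hp).eq_or_lt with rfl | hlt
      · exact (neg_le_neg (le_max_right _ _)).trans (abs_le.mp (hb x hx)).1
      · exact (neg_le_neg (le_max_left _ _)).trans (general p hp x hx ⟨m, hm, hlt⟩)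
    · push Not at h
      exact ⟨B, fun p hp x hx => general p hp x hx (h p hp)⟩
  obtain ⟨U, hU⟩ := upper
  obtain ⟨U', hU'⟩ := lower
  refine ⟨max U U', fun p hp x hx => abs_le.mpr ⟨?_, ?_⟩⟩
  · exact (neg_le_neg (le_max_right _ _)).trans (hU' p hp x hx)
  · exact (hU p hp x hx).trans (le_max_left _ _)

theorem exists_unique_witness (Q : ℝ → Prop) (h : ∀ p p', Q p → Q p' → p = p') :
    ∃ p₀, ∀ p, Q p → p = p₀ := by
  by_cases hq : ∃ p, Q p
  · obtain ⟨p, hp⟩ := hq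
    exact ⟨p, fun p' hp' => h p' p hp' hp⟩
  · exact ⟨0, fun p hp => (hq ⟨p, hp⟩).elim⟩

/-- Covering numbers of a set together with sequences attached to the gaps next to its points. -/
theorem HasCover.attach {Ω Ω' : Set ℝ} {δ K : ℝ} (hδ : 0 ≤ δ) (hc : HasCover Ω' δ K)
    (σ ρ : ℝ → ℕ → ℝ) (m : ℕ)
    (hσ : ∀ p ∈ Ω', (∀ n, Disjoint Ω' (uIoo p (σ p n))) ∧ ∀ n, m ≤ n → |σ p n - p| ≤ δ)
    (hρ : ∀ p ∈ Ω', (∀ n, Disjoint Ω' (uIoo p (ρ p n))) ∧ ∀ n, m ≤ n → |ρ p n - p| ≤ δ)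
    (hΩ : Ω ⊆ Ω' ∪ ⋃ p ∈ Ω', (range (σ p) ∪ range (ρ p))) :
    HasCover Ω δ (K * (5 + 4 * m)) := by
  classical
  obtain ⟨t, ht, htc⟩ := hc
  set S : ℝ → Set ℝ := fun p => range (σ p) ∪ range (ρ p) with hS
  have hgap : ∀ p ∈ Ω', ∀ x ∈ S p, Disjoint Ω' (uIoo p x) := by
    rintro p hp x (⟨n, rfl⟩ | ⟨n, rfl⟩)
    · exact (hσ p hp).1 n
    · exact (hρ p hp).1 n
  -- Only the rightmost point of `Ω'` in a covering interval can have terms beyond its right end,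
  -- for any other would have a point of `Ω'` in between; `hL` is the mirror image.
  have hR : ∀ c : ℝ, ∃ p₀, ∀ p, (p ∈ Ω' ∧ p ∈ Icc c (c + δ) ∧ ∃ x ∈ S p, c + δ < x) → p = p₀ := by
    have key : ∀ c p p' : ℝ, p ∈ Ω' → p' ∈ Ω' → p' ≤ c + δ → (∃ x ∈ S p, c + δ < x) →
        ¬ p < p' := by
      rintro c p p' hp hp' hle ⟨x, hx, hlt⟩ h
      refine Set.disjoint_left.mp (hgap p hp x hx) hp' ?_
      rw [uIoo_of_lt (by linarith)]
      exact ⟨h, by linarith⟩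
    intro c
    refine exists_unique_witness _ ?_
    rintro p p' ⟨h1, h2, h3⟩ ⟨h4, h5, h6⟩
    exact le_antisymm (not_lt.mp (key c p' p h4 h1 h2.2 h6)) (not_lt.mp (key c p p' h1 h4 h5.2 h3))
  have hL : ∀ c : ℝ, ∃ p₀, ∀ p, (p ∈ Ω' ∧ p ∈ Icc c (c + δ) ∧ ∃ x ∈ S p, x < c) → p = p₀ := by
    have key : ∀ c p p' : ℝ, p ∈ Ω' → p' ∈ Ω' → c ≤ p' → (∃ x ∈ S p, x < c) →
        ¬ p' < p := by
      rintro c p p' hp hp' hle ⟨x, hx, hlt⟩ h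
      refine Set.disjoint_left.mp (hgap p hp x hx) hp' ?_
      rw [uIoo_of_gt (by linarith)]
      exact ⟨by linarith, h⟩
    intro c
    refine exists_unique_witness _ ?_
    rintro p p' ⟨h1, h2, h3⟩ ⟨h4, h5, h6⟩
    exact le_antisymm (not_lt.mp (key c p p' h1 h4 h5.1 h3)) (not_lt.mp (key c p' p h4 h1 h2.1 h6))
  choose PR hPR using hR
  choose PL hPL using hL
  set W : ℝ → Finset ℝ := fun p => seqCover p δ (σ p) (ρ p) m with hW
  -- Each old interval is kept and joined by the covers for its two exceptional points: `1 + 2 (2 +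
  -- 2 m) = 5 + 4 m` intervals.
  refine ⟨t.biUnion fun c => {c} ∪ (W (PR c) ∪ W (PL c)), ?_, ?_⟩
  · have h1 : (t.biUnion fun c => {c} ∪ (W (PR c) ∪ W (PL c))).card ≤ t.card * (5 + 4 * m) := by
      refine Finset.card_biUnion_le_card_mul _ _ _ fun c _ => ?_
      refine (Finset.card_union_le _ _).trans ?_
      have h2 := Finset.card_union_le (W (PR c)) (W (PL c))
      have h3 : (W (PR c)).card ≤ 2 + (m + m) := card_seqCover_le _ _ _ _ _
      have h4 : (W (PL c)).card ≤ 2 + (m + m) := card_seqCover_le _ _ _ _ _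
      rw [Finset.card_singleton]
      omega
    calc (((t.biUnion fun c => {c} ∪ (W (PR c) ∪ W (PL c))).card : ℕ) : ℝ)
        ≤ ((t.card * (5 + 4 * m) : ℕ) : ℝ) := Nat.cast_le.mpr h1
      _ = t.card * (5 + 4 * m) := by push_cast; ring
      _ ≤ K * (5 + 4 * m) := by gcongr
  · intro x hx
    have main : ∃ c ∈ t, ∃ e ∈ ({c} ∪ (W (PR c) ∪ W (PL c)) : Finset ℝ), x ∈ Icc e (e + δ) := by
      rcases hΩ hx with hx' | hx'
      · have := htc hx'
        simp only [mem_iUnion] at this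
        obtain ⟨c, hc, hxc⟩ := this
        exact ⟨c, hc, c, by simp, hxc⟩
      · simp only [mem_iUnion] at hx'
        obtain ⟨p, hp, hxp⟩ := hx'
        have := htc hp
        simp only [mem_iUnion] at this
        obtain ⟨c, hc, hpc⟩ := this
        refine ⟨c, hc, ?_⟩
        obtain ⟨e, he, hxe⟩ := exists_mem_seqCover hδ (hσ p hp).2 (hρ p hp).2 hxp
        by_cases h1 : x < c
        · have e1 := hPL c p ⟨hp, hpc, x, hxp, h1⟩
          refine ⟨e, ?_, hxe⟩
          rw [← e1]
          exact Finset.mem_union_right _ (Finset.mem_union_right _ he)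
        · by_cases h2 : c + δ < x
          · have e1 := hPR c p ⟨hp, hpc, x, hxp, h2⟩
            refine ⟨e, ?_, hxe⟩
            rw [← e1]
            exact Finset.mem_union_right _ (Finset.mem_union_left _ he)
          · exact ⟨c, by simp, not_lt.mp h1, not_lt.mp h2⟩
    obtain ⟨c, hc, e, he, hxe⟩ := main
    exact mem_biUnion (Finset.mem_biUnion.mpr ⟨c, hc, he⟩) hxe

/-- Lacunary sets of order `M` are bounded and have logarithmic covering numbers. -/
theorem IsLacunaryOfOrder.bounded_and_hasCover {M : ℕ} {Ω : Set ℝ} (h : IsLacunaryOfOrder M Ω) :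
    (∃ B, ∀ x ∈ Ω, |x| ≤ B) ∧
      ∃ C : ℝ, 0 ≤ C ∧ ∀ δ : ℝ, 0 < δ → δ ≤ 1 → HasCover Ω δ (C * log2 (1 / δ) ^ M) := by
  induction h with
  | one Ω A p ω hA hω hΩ =>
    constructor
    · refine ⟨|p| + |ω 0 - p|, fun x hx => ?_⟩
      obtain ⟨n, rfl⟩ := hΩ hx
      have h1 := hω.abs_sub_le_first hA n
      have h2 := abs_add_le (ω n - p) p
      rw [sub_add_cancel] at h2
      linarith
    · obtain ⟨C, hC, hm⟩ := exists_tail_index hω.ratio_pos hA |ω 0 - p|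
      refine ⟨2 + (C + C), by positivity, fun δ hδ hδ1 => ?_⟩
      obtain ⟨m, hmC, hmt⟩ := hm δ hδ hδ1
      have ht := hmt p ω hω le_rfl
      refine ⟨seqCover p δ ω ω m, ?_, fun x hx => ?_⟩
      · have h1 : ((seqCover p δ ω ω m).card : ℝ) ≤ ((2 + (m + m) : ℕ) : ℝ) :=
          Nat.cast_le.mpr (card_seqCover_le _ _ _ _ _)
        push_cast at h1
        have h2 := one_le_log2 (1 / δ)
        rw [pow_one]
        linarith
      · obtain ⟨c, hc, hxc⟩ := exists_mem_seqCover hδ.le ht ht (Or.inl (hΩ hx))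
        exact mem_biUnion hc hxc
  | succ M Ω Ω' h A σ ρ hA hσ hρ hΩ ih =>
    obtain ⟨⟨B, hB⟩, C, hC, hcov⟩ := ih
    set S : ℝ → Set ℝ := fun p => range (σ p) ∪ range (ρ p) with hS
    have hSb : ∀ p ∈ Ω', ∃ b, ∀ x ∈ S p, |x| ≤ b := by
      intro p hp
      refine ⟨|p| + (|σ p 0 - p| + |ρ p 0 - p|), ?_⟩
      rintro x (⟨n, rfl⟩ | ⟨n, rfl⟩)
      · have h1 := (hσ p hp).1.abs_sub_le_first hA n
        have h2 := abs_add_le (σ p n - p) p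
        rw [sub_add_cancel] at h2
        linarith [abs_nonneg (ρ p 0 - p)]
      · have h1 := (hρ p hp).1.abs_sub_le_first hA n
        have h2 := abs_add_le (ρ p n - p) p
        rw [sub_add_cancel] at h2
        linarith [abs_nonneg (σ p 0 - p)]
    have hgap : ∀ p ∈ Ω', ∀ x ∈ S p, Disjoint Ω' (uIoo p x) := by
      rintro p hp x (⟨n, rfl⟩ | ⟨n, rfl⟩)
      · exact (hσ p hp).2 n
      · exact (hρ p hp).2 n
    obtain ⟨B', hB'⟩ := exists_bound_gap_terms hB S hSb hgap
    constructor
    · refine ⟨max B B', fun x hx => ?_⟩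
      rcases hΩ hx with hx' | hx'
      · exact (hB x hx').trans (le_max_left _ _)
      · simp only [mem_iUnion] at hx'
        obtain ⟨p, hp, hxp⟩ := hx'
        exact (hB' p hp x hxp).trans (le_max_right _ _)
    · rcases Ω'.eq_empty_or_nonempty with hemp | ⟨p₀, hp₀⟩
      · refine ⟨0, le_rfl, fun δ _ _ => ⟨∅, by simp, ?_⟩⟩
        intro x hx
        have := hΩ hx
        simp [hemp] at this
      · obtain ⟨C', hC', hm⟩ := exists_tail_index (hσ p₀ hp₀).1.ratio_pos hA (B' + B)
        refine ⟨C * (5 + 4 * C'), by positivity, fun δ hδ hδ1 => ?_⟩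
        obtain ⟨m, hmC, hmt⟩ := hm δ hδ hδ1
        have hfirst : ∀ p ∈ Ω', ∀ x ∈ S p, |x - p| ≤ B' + B := fun p hp x hx =>
          (abs_sub _ _).trans (add_le_add (hB' p hp x hx) (hB p hp))
        obtain ⟨t, ht, htc⟩ := (hcov δ hδ hδ1).attach (Ω := Ω) hδ.le σ ρ m
          (fun p hp => ⟨(hσ p hp).2, hmt p _ (hσ p hp).1 (hfirst p hp _ (Or.inl ⟨0, rfl⟩))⟩)
          (fun p hp => ⟨(hρ p hp).2, hmt p _ (hρ p hp).1 (hfirst p hp _ (Or.inr ⟨0, rfl⟩))⟩) hΩ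
        refine ⟨t, ht.trans ?_, htc⟩
        have h2 := one_le_log2 (1 / δ)
        calc C * log2 (1 / δ) ^ M * (5 + 4 * m)
            ≤ C * log2 (1 / δ) ^ M * ((5 + 4 * C') * log2 (1 / δ)) := by
              refine mul_le_mul_of_nonneg_left ?_ (by positivity)
              linarith
          _ = C * (5 + 4 * C') * log2 (1 / δ) ^ (M + 1) := by rw [pow_succ]; ring

/-! ### Covering numbers of the direction set and Minkowski dimension -/

theorem HasCover.directions {Ω : Set ℝ} {δ n : ℝ} (hδ : 0 ≤ δ) (h : HasCover Ω δ n) :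
    HasCover (directions Ω) δ (2 * n + 2) := by
  classical
  obtain ⟨t, ht, htc⟩ := h
  refine ⟨(t ∪ {0}) ∪ (t.image (fun c => c + Real.pi / 2) ∪ {Real.pi / 2}), ?_, ?_⟩
  · have h1 := Finset.card_union_le (t ∪ {0})
      (t.image (fun c => c + Real.pi / 2) ∪ {Real.pi / 2})
    have h2 := Finset.card_union_le t {0}
    have h3 := Finset.card_union_le (t.image (fun c => c + Real.pi / 2)) {Real.pi / 2}
    have h4 : (t.image (fun c => c + Real.pi / 2)).card ≤ t.card := Finset.card_image_le
    rw [Finset.card_singleton] at h2 h3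
    have h5 : ((t ∪ {0}) ∪ (t.image (fun c => c + Real.pi / 2) ∪ {Real.pi / 2})).card ≤
        2 * t.card + 2 := by omega
    have h6 : ((((t ∪ {0}) ∪ (t.image (fun c => c + Real.pi / 2) ∪ {Real.pi / 2})).card : ℕ) : ℝ) ≤
        ((2 * t.card + 2 : ℕ) : ℝ) := Nat.cast_le.mpr h5
    push_cast at h6
    linarith
  · rintro x (((hx | rfl) | ⟨θ, hθ, rfl⟩) | rfl)
    · have := htc hx
      simp only [mem_iUnion] at this
      obtain ⟨c, hc, hxc⟩ := this
      exact mem_biUnion (by simp [hc]) hxc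
    · exact mem_biUnion (show (0 : ℝ) ∈ (_ : Finset ℝ) by simp) ⟨le_rfl, by linarith⟩
    · have := htc hθ
      simp only [mem_iUnion] at this
      obtain ⟨c, hc, hxc⟩ := this
      refine mem_biUnion (show c + Real.pi / 2 ∈ (_ : Finset ℝ) by simp [hc]) ⟨?_, ?_⟩
      · linarith [hxc.1]
      · linarith [hxc.2]
    · exact mem_biUnion (show Real.pi / 2 ∈ (_ : Finset ℝ) by simp) ⟨le_rfl, by linarith⟩

theorem HasCover.mono {Ω : Set ℝ} {δ δ' n n' : ℝ} (h : HasCover Ω δ n) (hδ : δ ≤ δ')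
    (hn : n ≤ n') : HasCover Ω δ' n' := by
  obtain ⟨t, ht, htc⟩ := h
  refine ⟨t, ht.trans hn, htc.trans (iUnion₂_mono fun c _ => Icc_subset_Icc le_rfl (by linarith))⟩

theorem hasCover_Icc {δ : ℝ} (hδ : 0 < δ) (L : ℝ) (hL : 0 ≤ L) : HasCover (Icc 0 L) δ (L / δ + 1) := by
  classical
  refine ⟨(Finset.range (⌊L / δ⌋₊ + 1)).image (fun i : ℕ => (i : ℝ) * δ), ?_, fun x hx => ?_⟩
  · have h1 : ((Finset.range (⌊L / δ⌋₊ + 1)).image (fun i : ℕ => (i : ℝ) * δ)).card ≤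
        ⌊L / δ⌋₊ + 1 := Finset.card_image_le.trans (Finset.card_range _).le
    have h2 : (((Finset.range (⌊L / δ⌋₊ + 1)).image (fun i : ℕ => (i : ℝ) * δ)).card : ℝ) ≤
        ((⌊L / δ⌋₊ + 1 : ℕ) : ℝ) := Nat.cast_le.mpr h1
    push_cast at h2
    have := Nat.floor_le (show 0 ≤ L / δ by positivity)
    linarith
  · have hxd : 0 ≤ x / δ := div_nonneg hx.1 hδ.le
    have h1 : ⌊x / δ⌋₊ ≤ ⌊L / δ⌋₊ := Nat.floor_mono (by have := hx.2; gcongr)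
    refine mem_biUnion (show (⌊x / δ⌋₊ : ℝ) * δ ∈ (_ : Finset ℝ) from
      Finset.mem_image.mpr ⟨⌊x / δ⌋₊, Finset.mem_range.mpr (by omega), rfl⟩) ⟨?_, ?_⟩
    · rw [← le_div_iff₀ hδ]
      exact Nat.floor_le hxd
    · have := (Nat.lt_floor_add_one (x / δ)).le
      rw [div_le_iff₀ hδ] at this
      linarith

/-- Covering numbers of a set of upper Minkowski dimension less than `s`. -/
theorem hasCover_of_upperMinkowskiDim_lt {Ω : Set ℝ} (hΩ : Ω ⊆ Icc 0 (Real.pi / 2)) {s : ℝ}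
    (hs : upperMinkowskiDim Ω < s) :
    ∃ C : ℝ, 0 ≤ C ∧ ∀ δ : ℝ, 0 < δ → δ ≤ 1 → HasCover Ω δ (C * δ ^ (-s)) := by
  have hpi := Real.pi_pos
  -- Boundedness of `Ω` makes `1` a covering exponent, so the infimum is a genuine one and not the
  -- value at the empty set.
  have hne : {s : ℝ | 0 ≤ s ∧ IsCoveringExponent Ω s}.Nonempty := by
    refine ⟨1, zero_le_one, Real.pi / 2 + 1, 1, zero_lt_one, fun δ hδ hδ1 => ?_⟩
    obtain ⟨t, ht, htc⟩ := hasCover_Icc hδ (Real.pi / 2) (by positivity)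
    refine ⟨t, ht.trans ?_, hΩ.trans htc⟩
    rw [Real.rpow_neg_one, add_mul, one_mul, ← div_eq_mul_inv]
    gcongr
    exact (one_le_inv₀ hδ).mpr hδ1.le
  obtain ⟨s', ⟨hs'0, C, δ₀, hδ₀, hC⟩, hs'⟩ := exists_lt_of_csInf_lt hne hs
  set δ₁ := min δ₀ 1 / 2 with hδ₁
  have hδ₁0 : 0 < δ₁ := by have := lt_min hδ₀ one_pos; positivity
  have hδ₁1 : δ₁ < δ₀ := by
    have h1 : min δ₀ 1 ≤ δ₀ := min_le_left _ _
    have := lt_min hδ₀ one_pos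
    rw [hδ₁]; linarith
  have hδ₁2 : δ₁ ≤ 1 := by
    have h1 : min δ₀ 1 ≤ 1 := min_le_right _ _
    rw [hδ₁]; linarith
  obtain ⟨t₁, ht₁, htc₁⟩ := hC δ₁ hδ₁0 hδ₁1
  refine ⟨max C 0 + t₁.card, by positivity, fun δ hδ hδ1 => ?_⟩
  have hp : 1 ≤ δ ^ (-s) := Real.one_le_rpow_of_pos_of_le_one_of_nonpos hδ hδ1 (by linarith)
  have hC0 : 0 ≤ max C 0 := le_max_right _ _
  have hc0 : (0 : ℝ) ≤ t₁.card := Nat.cast_nonneg _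
  rcases lt_or_ge δ δ₀ with h | h
  · obtain ⟨t, ht, htc⟩ := hC δ hδ h
    refine ⟨t, ht.trans ?_, htc⟩
    calc C * δ ^ (-s') ≤ max C 0 * δ ^ (-s') := by
          gcongr; exact le_max_left _ _
      _ ≤ max C 0 * δ ^ (-s) := by
          refine mul_le_mul_of_nonneg_left ?_ hC0
          exact Real.rpow_le_rpow_of_exponent_ge hδ hδ1 (by linarith)
      _ ≤ _ := by gcongr; linarith
  -- Scales between `δ₀` and `1` reuse the one cover at the smaller scale `δ₁`.
  · refine HasCover.mono ⟨t₁, le_rfl, htc₁⟩ (hδ₁1.le.trans h) ?_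
    nlinarith

/-- The least number of intervals of length `δ` which cover `Ω`. -/
def coverNum (Ω : Set ℝ) (δ : ℝ) : ℕ := sInf {n : ℕ | HasCover Ω δ n}

theorem HasCover.coverNum_le {Ω : Set ℝ} {δ n : ℝ} (h : HasCover Ω δ n) :
    (coverNum Ω δ : ℝ) ≤ n ∧ HasCover Ω δ (coverNum Ω δ) := by
  obtain ⟨t, ht, htc⟩ := h
  have hmem : t.card ∈ {n : ℕ | HasCover Ω δ n} := ⟨t, le_rfl, htc⟩
  refine ⟨?_, Nat.sInf_mem (s := {n : ℕ | HasCover Ω δ n}) ⟨_, hmem⟩⟩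
  exact (Nat.cast_le.mpr (Nat.sInf_le hmem)).trans ht

/-! ### Construction of the rotation angle by nested intervals -/

theorem abs_tan_sub_mul {x y : ℝ} (hx : Real.cos x ≠ 0) (hy : Real.cos y ≠ 0) :
    |Real.tan x - Real.tan y| * (|Real.cos x| * |Real.cos y|) = |Real.sin (x - y)| := by
  rw [← abs_mul, ← abs_mul, Real.tan_eq_sin_div_cos, Real.tan_eq_sin_div_cos, Real.sin_sub]
  congr 1
  field_simp

theorem two_div_pi_mul_abs_le {y : ℝ} (hy : |y| ≤ Real.pi / 2) :
    2 / Real.pi * |y| ≤ |Real.sin y| := by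
  have h := Real.mul_le_sin (abs_nonneg y) hy
  rcases abs_choice y with h' | h'
  · rw [h'] at h ⊢
    exact h.trans (le_abs_self _)
  · rw [h'] at h ⊢
    rw [Real.sin_neg] at h
    exact h.trans (neg_le_abs _)

/-- The integer `p q' - q p'` has absolute value at most `B q q' < 1`, hence vanishes. -/
theorem eq_of_abs_div_sub_div_lt {p p' : ℤ} {q q' : ℕ} {B : ℝ} (hq : 1 ≤ q) (hq' : 1 ≤ q')
    (h1 : B * (q : ℝ) ^ 2 < 1) (h2 : B * (q' : ℝ) ^ 2 < 1)
    (h : |(p : ℝ) / q - (p' : ℝ) / q'| ≤ B) : (p : ℝ) / q = (p' : ℝ) / q' := by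
  have hq0 : (0 : ℝ) < q := by exact_mod_cast hq
  have hq0' : (0 : ℝ) < q' := by exact_mod_cast hq'
  have hprod : B * (q * q') < 1 := by
    rcases le_total (q : ℝ) q' with h3 | h3 <;> nlinarith
  rw [div_sub_div _ _ hq0.ne' hq0'.ne', abs_div, abs_of_pos (mul_pos hq0 hq0'),
    div_le_iff₀ (mul_pos hq0 hq0')] at h
  have h3 : |((p * q' - q * p' : ℤ) : ℝ)| < 1 := by
    push_cast
    linarith
  have h4 : p * q' - q * p' = 0 := Int.abs_lt_one_iff.mp (by exact_mod_cast h3)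
  rw [div_eq_div_iff hq0.ne' hq0'.ne']
  have h5 : ((p * q' - q * p' : ℤ) : ℝ) = 0 := by rw [h4]; simp
  push_cast at h5
  linarith

/-- Rotation angles which are bad for directions in one short interval are close together. -/
theorem abs_sub_le_of_near_fractions {c₀ ℓ δ α α' θ θ' : ℝ} (hc₀ : 0 < c₀) (hℓ1 : ℓ ≤ 1)
    (hδ : 0 < δ) (hδℓ : 10 * δ ≤ ℓ)
    (hcos : c₀ ≤ |Real.cos (α - θ)|) (hcos' : c₀ ≤ |Real.cos (α' - θ')|)
    (hα : |α - α'| ≤ ℓ) (hθ : |θ - θ'| ≤ δ) {p p' : ℤ} {q q' : ℕ} (hq : 1 ≤ q) (hq' : 1 ≤ q')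
    (h1 : 2 * (1 + 1 / c₀ ^ 2) * ℓ * (q : ℝ) ^ 2 < 1)
    (h2 : 2 * (1 + 1 / c₀ ^ 2) * ℓ * (q' : ℝ) ^ 2 < 1)
    (hb : |Real.tan (α - θ) - (p : ℝ) / q| ≤ δ) (hb' : |Real.tan (α' - θ') - (p' : ℝ) / q'| ≤ δ) :
    |α - α'| ≤ 5 * δ := by
  have hx : Real.cos (α - θ) ≠ 0 := abs_pos.mp (hc₀.trans_le hcos)
  have hx' : Real.cos (α' - θ') ≠ 0 := abs_pos.mp (hc₀.trans_le hcos')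
  have htan := abs_tan_sub_mul hx hx'
  have hdiff : |α - θ - (α' - θ')| ≤ ℓ + δ := by
    rw [show α - θ - (α' - θ') = (α - α') - (θ - θ') by ring]
    exact (abs_sub _ _).trans (add_le_add hα hθ)
  have hupper : |Real.tan (α - θ) - Real.tan (α' - θ')| ≤ 1 / c₀ ^ 2 * (ℓ + δ) := by
    have hs : |Real.sin (α - θ - (α' - θ'))| ≤ ℓ + δ := (Real.abs_sin_le_abs).trans hdiff
    rw [← htan] at hs
    have hcc : c₀ ^ 2 ≤ |Real.cos (α - θ)| * |Real.cos (α' - θ')| := by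
      rw [sq]; exact mul_le_mul hcos hcos' hc₀.le (abs_nonneg _)
    rw [one_div, inv_mul_eq_div, le_div_iff₀ (by positivity)]
    exact (mul_le_mul_of_nonneg_left hcc (abs_nonneg _)).trans hs
  have tri : ∀ x y z w : ℝ, |x - y| ≤ |z - x| + |z - w| + |w - y| := by
    intro x y z w
    have e : x - y = -(z - x) + (z - w) + (w - y) := by ring
    rw [e]
    refine (abs_add_le _ _).trans (add_le_add ((abs_add_le _ _).trans ?_) le_rfl)
    rw [abs_neg]
  -- The tangents differ by at most `(ℓ + δ) / c₀²` and each is within `δ` of its fraction, so the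
  -- fractions are within `2 (1 + 1 / c₀²) ℓ` and coincide.
  have hpq : (p : ℝ) / q = (p' : ℝ) / q' := by
    refine eq_of_abs_div_sub_div_lt hq hq' (B := 2 * (1 + 1 / c₀ ^ 2) * ℓ) h1 h2 ?_
    refine (tri _ _ (Real.tan (α - θ)) (Real.tan (α' - θ'))).trans ?_
    have h3 : 0 ≤ 1 / c₀ ^ 2 := by positivity
    nlinarith
  rw [← hpq] at hb'
  have hclose : |Real.tan (α - θ) - Real.tan (α' - θ')| ≤ 2 * δ := by
    have e : Real.tan (α - θ) - Real.tan (α' - θ') =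
      (Real.tan (α - θ) - (p : ℝ) / q) - (Real.tan (α' - θ') - (p : ℝ) / q) := by ring
    rw [e]
    exact (abs_sub _ _).trans (by linarith)
  have hsin : |Real.sin (α - θ - (α' - θ'))| ≤ 2 * δ := by
    rw [← htan]
    have hle : |Real.cos (α - θ)| * |Real.cos (α' - θ')| ≤ 1 :=
      mul_le_one₀ (Real.abs_cos_le_one _) (abs_nonneg _) (Real.abs_cos_le_one _)
    exact (mul_le_of_le_one_right (abs_nonneg _) hle).trans hclose
  have hpi := Real.pi_gt_three
  have hpi4 := Real.pi_le_four
  have h4 := two_div_pi_mul_abs_le (y := α - θ - (α' - θ')) (by linarith)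
  -- Both tangents are near the same fraction, so the sine of the difference is at most `2 δ`;
  -- Jordan's inequality gives `π δ`. Together with `|θ - θ'| ≤ δ` this stays below `5 δ`.
  have h5 : |α - θ - (α' - θ')| ≤ Real.pi * δ := by
    have h6 := h4.trans hsin
    rw [div_mul_eq_mul_div, div_le_iff₀ Real.pi_pos] at h6
    linarith
  have h6 : |α - α'| ≤ |α - θ - (α' - θ')| + |θ - θ'| := by
    have e : α - α' = (α - θ - (α' - θ')) + (θ - θ') := by ring
    rw [e]
    have := abs_add_le (α - θ - (α' - θ')) (θ - θ')
    linarith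
  nlinarith

theorem sub_le_card_mul_of_Icc_subset {a b w : ℝ} (hw : 0 ≤ w) (t : Finset ℝ) (f : ℝ → ℝ)
    (h : Icc a b ⊆ ⋃ c ∈ t, Icc (f c) (f c + w)) : b - a ≤ t.card * w := by
  have h1 : volume (Icc a b) ≤ ∑ c ∈ t, volume (Icc (f c) (f c + w)) :=
    (measure_mono h).trans (measure_biUnion_finset_le _ _)
  simp only [Real.volume_Icc, add_sub_cancel_left, Finset.sum_const, nsmul_eq_mul] at h1
  rw [← ENNReal.ofReal_natCast, ← ENNReal.ofReal_mul (Nat.cast_nonneg _)] at h1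
  exact (ENNReal.ofReal_le_ofReal_iff (by positivity)).mp h1

/-- A union bound: if every point were bad, at most `n` intervals of length `w` would cover `[a,
b]`. -/
theorem exists_mem_Icc_avoiding {D : Set ℝ} {δ w a b n : ℝ} (hD : HasCover D δ n) (hw : 0 ≤ w)
    (Bad : ℝ → ℝ → Prop) (f : ℝ → ℝ)
    (hBad : ∀ c s, (∃ θ ∈ D, θ ∈ Icc c (c + δ) ∧ Bad s θ) → s ∈ Icc (f c) (f c + w))
    (hab : n * w < b - a) : ∃ s ∈ Icc a b, ∀ θ ∈ D, ¬ Bad s θ := by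
  by_contra hcon
  push Not at hcon
  obtain ⟨t, ht, htc⟩ := hD
  have hsub : Icc a b ⊆ ⋃ c ∈ t, Icc (f c) (f c + w) := by
    intro s hs
    obtain ⟨θ, hθ, hbad⟩ := hcon s hs
    have := htc hθ
    simp only [mem_iUnion] at this
    obtain ⟨c, hc, hθc⟩ := this
    exact mem_biUnion hc (hBad c s ⟨θ, hθ, hθc, hbad⟩)
  have h1 := sub_le_card_mul_of_Icc_subset hw t f hsub
  have h2 : (t.card : ℝ) * w ≤ n * w := mul_le_mul_of_nonneg_right ht hw
  linarith

/-- One step of the construction of a badly approximable rotation angle. -/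
theorem exists_good_subinterval {D : Set ℝ} {K : ℝ → ℕ}
    (hcov : ∀ δ, 0 < δ → δ ≤ 1 → HasCover D δ (K δ))
    (hdecay : ∀ ε : ℝ, 0 < ε → ∃ δ₀ : ℝ, 0 < δ₀ ∧ ∀ δ, 0 < δ → δ ≤ δ₀ → (K δ : ℝ) * δ < ε)
    {c₀ a ℓ : ℝ} (hc₀ : 0 < c₀) (hℓ : 0 < ℓ) (hℓ1 : ℓ ≤ 1)
    (hcos : ∀ α ∈ Icc a (a + ℓ), ∀ θ ∈ D, c₀ ≤ |Real.cos (α - θ)|) :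
    ∃ a' ℓ' : ℝ, 0 < ℓ' ∧ ℓ' ≤ ℓ / 2 ∧ a ≤ a' ∧ a' + ℓ' ≤ a + ℓ ∧
      ℓ ≤ (2 * (K (ℓ' / 5) : ℝ) + 1) * (2 * ℓ') ∧
      ∀ α ∈ Icc a' (a' + ℓ'), ∀ θ ∈ D, ∀ (p : ℤ) (q : ℕ), 1 ≤ q →
        2 * (1 + 1 / c₀ ^ 2) * ℓ * (q : ℝ) ^ 2 < 1 →
          ℓ' / 10 < |Real.tan (α - θ) - (p : ℝ) / q| := by
  classical
  -- The new length is the largest halving of `ℓ` for which the counting argument works. Failure at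
  -- the previous halving is the reverse inequality, which keeps `ℓ'` from being too small.
  have hex : ∃ i : ℕ, (2 * (K (ℓ * (1 / 2) ^ i / 10) : ℝ) + 1) * (ℓ * (1 / 2) ^ i) < ℓ := by
    obtain ⟨δ₀, hδ₀, hK⟩ := hdecay (ℓ / 40) (by positivity)
    obtain ⟨i, hi⟩ := exists_pow_lt_of_lt_one (show 0 < min (δ₀ / ℓ) (1 / 4) by positivity)
      (show (1 / 2 : ℝ) < 1 by norm_num)
    have h1 : (1 / 2 : ℝ) ^ i < δ₀ / ℓ := hi.trans_le (min_le_left _ _)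
    have h2 : (1 / 2 : ℝ) ^ i < 1 / 4 := hi.trans_le (min_le_right _ _)
    rw [lt_div_iff₀ hℓ] at h1
    refine ⟨i, ?_⟩
    have h3 := hK (ℓ * (1 / 2) ^ i / 10) (by positivity) (by nlinarith)
    nlinarith
  set i := Nat.find hex with hi
  have hgood := Nat.find_spec hex
  rw [← hi] at hgood
  have hi0 : i ≠ 0 := by
    intro h0
    rw [h0, pow_zero, mul_one] at hgood
    have : (0 : ℝ) ≤ K (ℓ / 10) := Nat.cast_nonneg _
    nlinarith
  obtain ⟨j, hj⟩ := Nat.exists_eq_succ_of_ne_zero hi0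
  have hfail := Nat.find_min hex (m := j) (by rw [← hi, hj]; exact Nat.lt_succ_self j)
  set ℓ' := ℓ * (1 / 2) ^ i with hℓ'
  have hj2 : ℓ * (1 / 2) ^ j = 2 * ℓ' := by
    rw [hℓ', hj, pow_succ]; ring
  rw [hj2, not_lt, show 2 * ℓ' / 10 = ℓ' / 5 by ring] at hfail
  have hℓ'0 : 0 < ℓ' := by positivity
  have hℓ'2 : ℓ' ≤ ℓ / 2 := by
    have : (1 / 2 : ℝ) ^ j ≤ 1 := pow_le_one₀ (by norm_num) (by norm_num)
    nlinarith
  have hδ0 : 0 < ℓ' / 10 := by positivity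
  set A := 2 * (1 + 1 / c₀ ^ 2) with hA
  have hcover := hcov (ℓ' / 10) hδ0 (by linarith)
  have hcell : ∀ c : ℝ, ∃ α₀, ∀ α ∈ Icc a (a + ℓ), ∀ θ ∈ D, θ ∈ Icc c (c + ℓ' / 10) →
      ∀ (p : ℤ) (q : ℕ), 1 ≤ q → A * ℓ * (q : ℝ) ^ 2 < 1 →
        |Real.tan (α - θ) - (p : ℝ) / q| ≤ ℓ' / 10 → |α - α₀| ≤ 5 * (ℓ' / 10) := by
    intro c
    by_cases hex : ∃ α₀ ∈ Icc a (a + ℓ), ∃ θ₀ ∈ D, θ₀ ∈ Icc c (c + ℓ' / 10) ∧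
      ∃ (p : ℤ) (q : ℕ), 1 ≤ q ∧ A * ℓ * (q : ℝ) ^ 2 < 1 ∧
        |Real.tan (α₀ - θ₀) - (p : ℝ) / q| ≤ ℓ' / 10
    · obtain ⟨α₀, hα₀, θ₀, hθ₀, hθc₀, p₀, q₀, hq₀, hA₀, hb₀⟩ := hex
      refine ⟨α₀, fun α hα θ hθ hθc p q hq hAq hb => ?_⟩
      refine abs_sub_le_of_near_fractions hc₀ hℓ1 hδ0 (by linarith) (hcos α hα θ hθ)
        (hcos α₀ hα₀ θ₀ hθ₀) ?_ ?_ hq hq₀ hAq hA₀ hb hb₀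
      · rw [abs_le]; constructor <;> linarith [hα.1, hα.2, hα₀.1, hα₀.2]
      · rw [abs_le]; constructor <;> linarith [hθc.1, hθc.2, hθc₀.1, hθc₀.2]
    · refine ⟨0, fun α hα θ hθ hθc p q hq hAq hb => ?_⟩
      exact (hex ⟨α, hα, θ, hθ, hθc, p, q, hq, hAq, hb⟩).elim
  choose α₀ hα₀ using hcell
  -- The bad angles for one covering interval lie within `ℓ' / 2` of `α₀ c`. An interval `[s, s +
  -- ℓ']` that meets them has `s` between `α₀ c - 3 ℓ' / 2` and `α₀ c + ℓ' / 2`, which explains `2 *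
  -- ℓ'`.
  obtain ⟨a', ha', hgoodθ⟩ := exists_mem_Icc_avoiding (a := a) (b := a + ℓ - ℓ') hcover
    (w := 2 * ℓ') (by positivity)
    (fun s θ => ∃ α ∈ Icc s (s + ℓ'), α ∈ Icc a (a + ℓ) ∧ ∃ (p : ℤ) (q : ℕ), 1 ≤ q ∧
      A * ℓ * (q : ℝ) ^ 2 < 1 ∧ |Real.tan (α - θ) - (p : ℝ) / q| ≤ ℓ' / 10)
    (fun c => α₀ c - 3 * ℓ' / 2) (by
      rintro c s ⟨θ, hθ, hθc, α, hαs, hαa, p, q, hq, hAq, hb⟩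
      have h1 := abs_le.mp (hα₀ c α hαa θ hθ hθc p q hq hAq hb)
      constructor <;> linarith [hαs.1, hαs.2, h1.1, h1.2]) (by linarith)
  refine ⟨a', ℓ', hℓ'0, hℓ'2, ha'.1, by linarith [ha'.2], hfail, ?_⟩
  intro α hα θ hθ p q hq hAq
  by_contra hcon
  refine hgoodθ θ hθ ⟨α, hα, ⟨ha'.1.trans hα.1, ?_⟩, p, q, hq, hAq, not_lt.mp hcon⟩
  linarith [hα.2, ha'.2]

/-- An interval of rotation angles for which all directions stay away from the vertical. -/
theorem exists_initial_interval {Ω : Set ℝ} (hΩ : Ω ⊆ Icc 0 (Real.pi / 2)) {K : ℝ → ℕ}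
    (hcov : ∀ δ, 0 < δ → δ ≤ 1 → HasCover (directions Ω) δ (K δ))
    (hdecay : ∀ ε : ℝ, 0 < ε → ∃ δ₀ : ℝ, 0 < δ₀ ∧ ∀ δ, 0 < δ → δ ≤ δ₀ → (K δ : ℝ) * δ < ε) :
    ∃ c₀ a ℓ : ℝ, 0 < c₀ ∧ 0 < ℓ ∧ ℓ ≤ 1 ∧ 0 ≤ a ∧ a + ℓ ≤ Real.pi / 2 ∧
      ∀ α ∈ Icc a (a + ℓ), ∀ θ ∈ directions Ω, c₀ ≤ |Real.cos (α - θ)| := by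
  have hpi := Real.pi_gt_three
  obtain ⟨δ₀, hδ₀, hK⟩ := hdecay (1 / 8) (by norm_num)
  set ρ := min δ₀ (1 / 2) with hρ
  have hρ0 : 0 < ρ := lt_min hδ₀ (by norm_num)
  have hρ1 : ρ ≤ 1 / 2 := min_le_right _ _
  have hKρ := hK ρ hρ0 (min_le_left _ _)
  -- Keeps a whole interval of angles at distance more than `ρ` from every direction. As `0`, `π/2`
  -- and `Ω + π/2` are among these, no `α - θ` comes near an odd multiple of `π/2`.
  obtain ⟨a, ha, hgood⟩ := exists_mem_Icc_avoiding (a := 0) (b := Real.pi / 2 - ρ)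
    (hcov ρ hρ0 (by linarith)) (w := 4 * ρ) (by positivity)
    (fun s θ => ∃ α ∈ Icc s (s + ρ), |α - θ| ≤ ρ) (fun c => c - 2 * ρ) (by
      rintro c s ⟨θ, -, hθc, α, hα, hb⟩
      rw [abs_le] at hb
      constructor <;> linarith [hα.1, hα.2, hθc.1, hθc.2]) (by nlinarith)
  have hsep : ∀ α ∈ Icc a (a + ρ), ∀ θ ∈ directions Ω, ρ < |α - θ| := by
    intro α hα θ hθ
    by_contra hcon
    exact hgood θ hθ ⟨α, hα, not_lt.mp hcon⟩
  refine ⟨Real.sin ρ, a, ρ, Real.sin_pos_of_pos_of_lt_pi hρ0 (by linarith), hρ0, by linarith, ha.1,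
    by linarith [ha.2], ?_⟩
  intro α hα θ hθ
  have hα0 : 0 ≤ α := ha.1.trans hα.1
  have hα1 : α ≤ Real.pi / 2 := by linarith [hα.2, ha.2]
  have s0 : ρ < α := by
    have := hsep α hα 0 (by simp [directions])
    rwa [sub_zero, abs_of_nonneg hα0] at this
  have s1 : ρ < Real.pi / 2 - α := by
    have := hsep α hα (Real.pi / 2) (by simp [directions])
    rwa [abs_sub_comm, abs_of_nonneg (by linarith)] at this
  have main : ∀ θ₀ ∈ Icc 0 (Real.pi / 2), θ₀ ∈ directions Ω →
      Real.sin ρ ≤ |Real.cos (α - θ₀)| ∧ Real.sin ρ ≤ |Real.cos (α - (θ₀ + Real.pi / 2))| := by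
    intro θ₀ hθ₀ hmem
    constructor
    · have h1 : |α - θ₀| ≤ Real.pi / 2 - ρ := by
        rw [abs_le]; constructor <;> linarith [hθ₀.1, hθ₀.2]
      refine le_trans ?_ (le_abs_self _)
      rw [← Real.cos_abs (α - θ₀), ← Real.cos_pi_div_two_sub]
      exact Real.cos_le_cos_of_nonneg_of_le_pi (abs_nonneg _) (by linarith) h1
    · have h1 := hsep α hα θ₀ hmem
      have h2 : |α - θ₀| ≤ Real.pi / 2 := by
        rw [abs_le]; constructor <;> linarith [hθ₀.1, hθ₀.2]
      rw [← sub_sub, Real.cos_sub_pi_div_two]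
      have h3 : Real.sin ρ ≤ Real.sin |α - θ₀| :=
        Real.sin_le_sin_of_le_of_le_pi_div_two (by linarith) h2 h1.le
      rcases abs_choice (α - θ₀) with h' | h'
      · rw [h'] at h3
        exact h3.trans (le_abs_self _)
      · rw [h', Real.sin_neg] at h3
        exact h3.trans (neg_le_abs _)
  rcases hθ with ((hθ | rfl) | ⟨θ₀, hθ₀, rfl⟩) | rfl
  · exact (main θ (hΩ hθ) (by simp [directions, hθ])).1
  · exact (main 0 ⟨le_rfl, by linarith⟩ (by simp [directions])).1
  · exact (main θ₀ (hΩ hθ₀) (by simp [directions, hθ₀])).2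
  · have := (main 0 ⟨le_rfl, by linarith⟩ (by simp [directions])).2
    rwa [zero_add] at this

/-- Existence of a rotation angle whose Diophantine quality is governed by covering numbers. -/
theorem exists_badly_approximable_angle {Ω : Set ℝ} (hΩ : Ω ⊆ Icc 0 (Real.pi / 2)) {K : ℝ → ℕ}
    (hcov : ∀ δ, 0 < δ → δ ≤ 1 → HasCover (directions Ω) δ (K δ))
    (hdecay : ∀ ε : ℝ, 0 < ε → ∃ δ₀ : ℝ, 0 < δ₀ ∧ ∀ δ, 0 < δ → δ ≤ δ₀ → (K δ : ℝ) * δ < ε) :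
    ∃ α ∈ Icc 0 (Real.pi / 2), ∃ c : ℝ, 0 < c ∧ ∀ q : ℕ, 1 ≤ q → ∃ ℓ ℓ' ℓ'' : ℝ,
      0 < ℓ' ∧ ℓ' ≤ 1 ∧ 0 < ℓ'' ∧ ℓ'' ≤ 1 ∧ c / (q : ℝ) ^ 2 ≤ ℓ ∧
      ℓ ≤ (2 * (K (ℓ' / 5) : ℝ) + 1) * (2 * ℓ') ∧ ℓ' ≤ (2 * (K (ℓ'' / 5) : ℝ) + 1) * (2 * ℓ'') ∧
      ∀ θ ∈ directions Ω, ∀ p : ℤ, ℓ'' / 10 < |Real.tan (α - θ) - (p : ℝ) / q| := by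
  obtain ⟨c₀, a₀, ℓ₀, hc₀, hℓ₀, hℓ₀1, ha₀, haℓ₀, hcos₀⟩ := exists_initial_interval hΩ hcov hdecay
  let State := {x : ℝ × ℝ // 0 < x.2 ∧ x.2 ≤ 1 ∧ a₀ ≤ x.1 ∧ x.1 + x.2 ≤ a₀ + ℓ₀}
  set A := 2 * (1 + 1 / c₀ ^ 2) with hA
  have hA0 : 0 < A := by positivity
  have step : ∀ x : State, ∃ y : State, y.1.2 ≤ x.1.2 / 2 ∧ x.1.1 ≤ y.1.1 ∧
      y.1.1 + y.1.2 ≤ x.1.1 + x.1.2 ∧ x.1.2 ≤ (2 * (K (y.1.2 / 5) : ℝ) + 1) * (2 * y.1.2) ∧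
      ∀ α ∈ Icc y.1.1 (y.1.1 + y.1.2), ∀ θ ∈ directions Ω, ∀ (p : ℤ) (q : ℕ), 1 ≤ q →
        A * x.1.2 * (q : ℝ) ^ 2 < 1 → y.1.2 / 10 < |Real.tan (α - θ) - (p : ℝ) / q| := by
    rintro ⟨⟨a, ℓ⟩, hℓ, hℓ1, ha, haℓ⟩
    obtain ⟨a', ℓ', h1, h2, h3, h4, h5, h6⟩ := exists_good_subinterval hcov hdecay hc₀ hℓ hℓ1
      (fun α hα θ hθ => hcos₀ α ⟨ha.trans hα.1, hα.2.trans haℓ⟩ θ hθ)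
    exact ⟨⟨⟨a', ℓ'⟩, h1, by dsimp only at *; linarith, ha.trans h3, h4.trans haℓ⟩, h2, h3, h4, h5, h6⟩
  choose next hnext using step
  let x₀ : State := ⟨⟨a₀, ℓ₀⟩, hℓ₀, hℓ₀1, le_rfl, le_rfl⟩
  set x : ℕ → State := fun n => next^[n] x₀ with hx
  have hsucc : ∀ n, x (n + 1) = next (x n) := fun n => Function.iterate_succ_apply' _ _ _
  have hinter : (⋂ n, Icc (x n).1.1 ((x n).1.1 + (x n).1.2)).Nonempty := by
    refine IsCompact.nonempty_iInter_of_sequence_nonempty_isCompact_isClosed _ (fun n => ?_)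
      (fun n => ?_) isCompact_Icc (fun n => isClosed_Icc)
    · rw [hsucc]
      exact Icc_subset_Icc (hnext (x n)).2.1 (hnext (x n)).2.2.1
    · exact nonempty_Icc.mpr (by linarith [(x n).2.1])
  obtain ⟨α, hα⟩ := hinter
  rw [mem_iInter] at hα
  have hlen : ∀ n, (x n).1.2 ≤ (1 / 2) ^ n := by
    intro n
    induction n with
    | zero => simpa using (x 0).2.2.1
    | succ n ih =>
      rw [hsucc, pow_succ]
      linarith [(hnext (x n)).1]
  have hα0 := hα 0
  refine ⟨α, ⟨ha₀.trans hα0.1, hα0.2.trans haℓ₀⟩, min ℓ₀ (1 / A), by positivity, ?_⟩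
  intro q hq
  have hq1 : (1 : ℝ) ≤ q := by exact_mod_cast hq
  have hq2 : (1 : ℝ) ≤ (q : ℝ) ^ 2 := one_le_pow₀ hq1
  -- The first such `j` gives the distance to fractions with denominator `q` in terms of the length
  -- at `j + 1`, while minimality bounds the length at `j - 1` below by `1 / (A q²)`.
  have hex : ∃ j, A * (x j).1.2 * (q : ℝ) ^ 2 < 1 := by
    obtain ⟨j, hj⟩ := exists_pow_lt_of_lt_one (show 0 < 1 / (A * (q : ℝ) ^ 2) by positivity)
      (show (1 / 2 : ℝ) < 1 by norm_num)
    refine ⟨j, ?_⟩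
    rw [lt_div_iff₀ (by positivity)] at hj
    have := hlen j
    calc A * (x j).1.2 * (q : ℝ) ^ 2 = (x j).1.2 * (A * (q : ℝ) ^ 2) := by ring
      _ ≤ (1 / 2) ^ j * (A * (q : ℝ) ^ 2) := by gcongr
      _ < 1 := hj
  classical
  have hj := Nat.find_spec hex
  have hmin := fun m => Nat.find_min hex (m := m)
  generalize Nat.find hex = j at hj hmin
  have hgood := (hnext (x j)).2.2.2.2 α (by rw [← hsucc]; exact hα (j + 1))
  -- If already `j = 0`, there is no preceding interval; the lengths at `0, 1, 2` are used, at the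
  -- cost of the weaker bound by the length at `2`.
  rcases Nat.eq_zero_or_eq_succ_pred j with h0 | h1
  · subst h0
    refine ⟨(x 0).1.2, (x 1).1.2, (x 2).1.2, (x 1).2.1, (x 1).2.2.1, (x 2).2.1, (x 2).2.2.1, ?_, ?_,
      ?_, ?_⟩
    · refine (div_le_self (by positivity) hq2).trans ?_
      exact min_le_left _ _
    · rw [hsucc 0]; exact (hnext (x 0)).2.2.2.1
    · rw [hsucc 1]; exact (hnext (x 1)).2.2.2.1
    · intro θ hθ p
      refine lt_of_le_of_lt ?_ (hgood θ hθ p q hq hj)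
      rw [← hsucc 0]
      have := (hnext (x 1)).1
      rw [← hsucc 1] at this
      have := (x 1).2.1
      norm_num at *
      linarith
  · obtain ⟨i, rfl⟩ : ∃ i, j = i + 1 := ⟨_, h1⟩
    have hi := hmin i (Nat.lt_succ_self i)
    refine ⟨(x i).1.2, (x (i + 1)).1.2, (x (i + 2)).1.2, (x _).2.1, (x _).2.2.1, (x _).2.1,
      (x _).2.2.1, ?_, ?_, ?_, ?_⟩
    · rw [not_lt] at hi
      refine (div_le_div_of_nonneg_right (min_le_right ℓ₀ (1 / A)) (by positivity)).trans ?_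
      rw [div_div, div_le_iff₀ (by positivity)]
      linarith
    · rw [hsucc i]; exact (hnext (x i)).2.2.2.1
    · rw [hsucc (i + 1)]; exact (hnext (x (i + 1))).2.2.2.1
    · intro θ hθ p
      rw [hsucc (i + 1)]
      exact hgood θ hθ p q hq hj

/-! ### Diophantine quality from covering numbers -/

theorem decay_of_rpow_bound {K : ℝ → ℕ} {C s : ℝ} (hs : s < 1) (hC : 0 ≤ C)
    (h : ∀ δ, 0 < δ → δ ≤ 1 → (K δ : ℝ) ≤ C * δ ^ (-s)) :
    ∀ ε : ℝ, 0 < ε → ∃ δ₀ : ℝ, 0 < δ₀ ∧ ∀ δ, 0 < δ → δ ≤ δ₀ → (K δ : ℝ) * δ < ε := by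
  intro ε hε
  have h1s : 0 < 1 - s := by linarith
  have hb : 0 < ε / (C + 1) := by positivity
  refine ⟨min 1 ((ε / (C + 1)) ^ (1 / (1 - s))), by positivity, fun δ hδ hle => ?_⟩
  have h1 := h δ hδ (hle.trans (min_le_left _ _))
  have h2 : δ ^ (1 - s) ≤ ε / (C + 1) := by
    have := Real.rpow_le_rpow hδ.le (hle.trans (min_le_right _ _)) h1s.le
    rwa [← Real.rpow_mul hb.le, one_div_mul_cancel h1s.ne', Real.rpow_one] at this
  have h3 : δ ^ (-s) * δ = δ ^ (1 - s) := by
    rw [← Real.rpow_add_one hδ.ne']; congr 1; ring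
  have h4 : 0 < δ ^ (1 - s) := by positivity
  calc (K δ : ℝ) * δ ≤ C * δ ^ (-s) * δ := by gcongr
    _ = C * δ ^ (1 - s) := by rw [mul_assoc, h3]
    _ < (C + 1) * δ ^ (1 - s) := by linarith
    _ ≤ (C + 1) * (ε / (C + 1)) := by gcongr
    _ = ε := by field_simp

theorem log2_pow_le_rpow (M : ℕ) :
    ∃ C : ℝ, 0 < C ∧ ∀ y : ℝ, 1 ≤ y → log2 y ^ M ≤ C * y ^ (1 / 2 : ℝ) := by
  -- Chosen so that `e * M ≤ 1 / 2`; `M + 1` also allows `M = 0`.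
  set e : ℝ := 1 / (2 * (M + 1)) with he
  have he0 : 0 < e := by positivity
  have hlog2 : 0 < Real.log 2 := Real.log_pos (by norm_num)
  set B : ℝ := 1 + 1 / (e * Real.log 2) with hB
  have hB0 : 0 < B := by positivity
  refine ⟨B ^ M, by positivity, fun y hy => ?_⟩
  have hy0 : 0 < y := by linarith
  have hye : 1 ≤ y ^ e := Real.one_le_rpow hy he0.le
  have h1 : log2 y ≤ B * y ^ e := by
    refine max_le ?_ ?_
    · have : (0 : ℝ) ≤ 1 / (e * Real.log 2) := by positivity
      rw [hB]; nlinarith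
    · have h2 := Real.log_le_rpow_div hy0.le he0
      rw [Real.logb, div_le_iff₀ hlog2]
      refine h2.trans ?_
      rw [hB]
      have : (1 + 1 / (e * Real.log 2)) * y ^ e * Real.log 2 =
          y ^ e * Real.log 2 + y ^ e / e := by field_simp
      rw [this]
      have : 0 < y ^ e * Real.log 2 := by positivity
      linarith
  calc log2 y ^ M ≤ (B * y ^ e) ^ M :=
        pow_le_pow_left₀ (zero_le_one.trans (one_le_log2 y)) h1 M
    _ = B ^ M * y ^ (e * M) := by
        rw [mul_pow, ← Real.rpow_natCast (y ^ e), ← Real.rpow_mul hy0.le]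
    _ ≤ B ^ M * y ^ (1 / 2 : ℝ) := by
        refine mul_le_mul_of_nonneg_left (Real.rpow_le_rpow_of_exponent_le hy ?_) (by positivity)
        rw [he, div_mul_eq_mul_div, one_mul, div_le_div_iff₀ (by positivity) (by norm_num)]
        linarith

theorem log2_le_mul_log2 {a : ℝ} (ha : 0 < a) (n : ℕ) :
    ∃ C : ℝ, 0 < C ∧ ∀ (q : ℕ) (y : ℝ), 1 ≤ q → 0 < y → y ≤ a * (q : ℝ) ^ n →
      log2 y ≤ C * log2 q := by
  refine ⟨1 + |Real.logb 2 a| + n, by positivity, fun q y hq hy hyq => ?_⟩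
  have hq0 : (0 : ℝ) < q := by exact_mod_cast hq
  have hL := one_le_log2 (q : ℝ)
  have hlq : Real.logb 2 q ≤ log2 q := le_max_right _ _
  have hn : (0 : ℝ) ≤ n := Nat.cast_nonneg n
  have ha' := abs_nonneg (Real.logb 2 a)
  refine max_le ?_ ?_
  · nlinarith
  · have h1 : Real.logb 2 y ≤ Real.logb 2 (a * (q : ℝ) ^ n) :=
      Real.logb_le_logb_of_le (by norm_num) hy hyq
    rw [Real.logb_mul ha.ne' (by positivity), Real.logb_pow] at h1
    have h2 := le_abs_self (Real.logb 2 a)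
    nlinarith

/-- Inversion of `ℓ ≤ (2 K (ℓ' / 5) + 1) 2 ℓ'` for logarithmic covering numbers. -/
theorem lower_bound_of_log_cover {K : ℝ → ℕ} {C : ℝ} {M : ℕ} (hC : 0 ≤ C)
    (h : ∀ δ, 0 < δ → δ ≤ 1 → (K δ : ℝ) ≤ C * log2 (1 / δ) ^ M) {c : ℝ} (hc : 0 < c) (m : ℕ) :
    ∃ c' : ℝ, 0 < c' ∧ ∀ (q : ℕ) (ℓ ℓ' : ℝ), 1 ≤ q → 0 < ℓ' → ℓ' ≤ 1 → c / (q : ℝ) ^ m ≤ ℓ →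
      ℓ ≤ (2 * (K (ℓ' / 5) : ℝ) + 1) * (2 * ℓ') →
        c' / (q : ℝ) ^ (2 * m) ≤ ℓ' ∧ c' * ℓ / log2 q ^ M ≤ ℓ' := by
  obtain ⟨C₂, hC₂, hroot⟩ := log2_pow_le_rpow M
  set C₁ : ℝ := (2 * C + 1) * 2 with hC₁
  have hC₁0 : 0 < C₁ := by positivity
  set C₃ : ℝ := C₁ * C₂ * 5 with hC₃
  have hC₃0 : 0 < C₃ := by positivity
  obtain ⟨C₄, hC₄, hlog⟩ := log2_le_mul_log2 (a := 5 / (c / C₃) ^ 2) (by positivity) (2 * m)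
  refine ⟨min ((c / C₃) ^ 2) (C₁ * C₄ ^ M)⁻¹, by positivity, ?_⟩
  intro q ℓ ℓ' hq hℓ'0 hℓ'1 hcℓ hℓK
  have hq0 : (0 : ℝ) < q := by exact_mod_cast hq
  have hy : 1 ≤ 5 / ℓ' := (one_le_div hℓ'0).mpr (by linarith)
  have hL1 : 1 ≤ log2 (5 / ℓ') ^ M := one_le_pow₀ (one_le_log2 _)
  have hLq : 0 < log2 (q : ℝ) := zero_lt_one.trans_le (one_le_log2 _)
  have hstep : ℓ ≤ C₁ * log2 (5 / ℓ') ^ M * ℓ' := by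
    have h1 := h (ℓ' / 5) (by positivity) (by linarith)
    rw [one_div_div] at h1
    refine hℓK.trans ?_
    have h2 : (2 * (K (ℓ' / 5) : ℝ) + 1) * 2 ≤ C₁ * log2 (5 / ℓ') ^ M := by
      rw [hC₁]; nlinarith
    nlinarith
  -- Bootstrap: the crude bound of the logarithm by a square root shows that `ℓ'` is at least a
  -- power of `1/q`. Then `log (1/ℓ')` is `O(log q)`, and the same inequality gives the sharp loss
  -- `log ^ M q`.
  have hsq : ℓ ^ 2 ≤ C₃ ^ 2 * ℓ' := by
    have h1 := hroot _ hy
    have h3 : ℓ ≤ C₁ * C₂ * ((5 / ℓ') ^ (1 / 2 : ℝ) * ℓ') := by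
      refine hstep.trans ?_
      have : C₁ * log2 (5 / ℓ') ^ M * ℓ' ≤ C₁ * (C₂ * (5 / ℓ') ^ (1 / 2 : ℝ)) * ℓ' := by gcongr
      linarith
    have hℓ0 : 0 ≤ ℓ := le_trans (by positivity) hcℓ
    have h4 := pow_le_pow_left₀ hℓ0 h3 2
    refine h4.trans ?_
    rw [mul_pow, mul_pow (_ ^ (1 / 2 : ℝ)), ← Real.sqrt_eq_rpow, Real.sq_sqrt (by positivity), hC₃]
    have : (C₁ * C₂) ^ 2 * (5 / ℓ' * ℓ' ^ 2) = (C₁ * C₂) ^ 2 * 5 * ℓ' := by field_simp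
    rw [this]
    nlinarith [mul_pos (show 0 < (C₁ * C₂) ^ 2 by positivity) hℓ'0]
  have hlow : (c / C₃) ^ 2 / (q : ℝ) ^ (2 * m) ≤ ℓ' := by
    have h1 : (c / (q : ℝ) ^ m) ^ 2 ≤ ℓ ^ 2 := pow_le_pow_left₀ (by positivity) hcℓ 2
    have h2 := h1.trans hsq
    have e : (c / C₃) ^ 2 / (q : ℝ) ^ (2 * m) = (c / (q : ℝ) ^ m) ^ 2 / C₃ ^ 2 := by
      rw [mul_comm 2 m, pow_mul]; field_simp
    rw [e, div_le_iff₀ (by positivity)]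
    linarith
  constructor
  · exact (div_le_div_of_nonneg_right (min_le_left _ _) (by positivity)).trans hlow
  · have h1 : log2 (5 / ℓ') ≤ C₄ * log2 q := by
      refine hlog q _ hq (by positivity) ?_
      rw [div_le_iff₀ hℓ'0]
      rw [div_le_iff₀ (by positivity)] at hlow
      rw [div_mul_eq_mul_div, div_mul_eq_mul_div, le_div_iff₀ (by positivity)]
      nlinarith
    have h2 : ℓ ≤ C₁ * C₄ ^ M * (log2 q ^ M * ℓ') := by
      refine hstep.trans ?_
      have h3 := pow_le_pow_left₀ (zero_le_one.trans (one_le_log2 _)) h1 M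
      rw [mul_pow] at h3
      calc C₁ * log2 (5 / ℓ') ^ M * ℓ' ≤ C₁ * (C₄ ^ M * log2 q ^ M) * ℓ' := by gcongr
        _ = _ := by ring
    have hℓ0 : 0 ≤ ℓ := le_trans (by positivity) hcℓ
    rw [div_le_iff₀ (by positivity)]
    calc min ((c / C₃) ^ 2) (C₁ * C₄ ^ M)⁻¹ * ℓ ≤ (C₁ * C₄ ^ M)⁻¹ * ℓ := by
          gcongr; exact min_le_right _ _
      _ ≤ (C₁ * C₄ ^ M)⁻¹ * (C₁ * C₄ ^ M * (log2 q ^ M * ℓ')) := by gcongr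
      _ = ℓ' * log2 q ^ M := by field_simp

theorem exists_isLogAngle {Ω : Set ℝ} (hΩ : Ω ⊆ Icc 0 (Real.pi / 2)) {M : ℕ}
    (h : IsLacunaryOfOrder M Ω) : ∃ α ∈ Icc 0 (Real.pi / 2), IsLogAngle M Ω α := by
  obtain ⟨-, C, hC, hcov⟩ := h.bounded_and_hasCover
  set K := coverNum (directions Ω) with hK
  have hcovD : ∀ δ, 0 < δ → δ ≤ 1 → HasCover (directions Ω) δ ((2 * C + 2) * log2 (1 / δ) ^ M) := by
    intro δ hδ hδ1
    refine (hcov δ hδ hδ1).directions hδ.le |>.mono le_rfl ?_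
    have : 1 ≤ log2 (1 / δ) ^ M := one_le_pow₀ (one_le_log2 _)
    linarith
  have hKb : ∀ δ, 0 < δ → δ ≤ 1 → (K δ : ℝ) ≤ (2 * C + 2) * log2 (1 / δ) ^ M :=
    fun δ hδ hδ1 => (hcovD δ hδ hδ1).coverNum_le.1
  obtain ⟨C₂, hC₂, hroot⟩ := log2_pow_le_rpow M
  have hdecay := decay_of_rpow_bound (K := K) (C := (2 * C + 2) * C₂) (s := 1 / 2) (by norm_num)
    (by positivity) (fun δ hδ hδ1 => by
      refine (hKb δ hδ hδ1).trans ?_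
      have h1 := hroot (1 / δ) ((one_le_div hδ).mpr hδ1)
      rw [one_div δ, Real.inv_rpow hδ.le, ← Real.rpow_neg hδ.le, ← one_div δ] at h1
      rw [mul_assoc]
      gcongr)
  obtain ⟨α, hα, c, hc, hq⟩ := exists_badly_approximable_angle hΩ
    (fun δ hδ hδ1 => (hcovD δ hδ hδ1).coverNum_le.2) hdecay
  obtain ⟨c₁, hc₁, h1⟩ := lower_bound_of_log_cover (by positivity) hKb hc 2
  -- The crude conclusion `c₁ / q ^ 4 ≤ ℓ'` of the first step is the input that the second one
  -- requires.
  obtain ⟨c₂, hc₂, h2⟩ := lower_bound_of_log_cover (by positivity) hKb hc₁ (2 * 2)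
  refine ⟨α, hα, c₂ * c₁ * c / 10, by positivity, fun θ hθ p q hq1 => ?_⟩
  obtain ⟨ℓ, ℓ', ℓ'', h01, h02, h03, h04, h05, h06, h07, h08⟩ := hq q hq1
  obtain ⟨h11, h12⟩ := h1 q ℓ ℓ' hq1 h01 h02 h05 h06
  obtain ⟨-, h22⟩ := h2 q ℓ' ℓ'' hq1 h03 h04 h11 h07
  refine lt_of_le_of_lt ?_ (h08 θ hθ p)
  have hq0 : (0 : ℝ) < q := by exact_mod_cast hq1
  have hL : 0 < log2 (q : ℝ) := zero_lt_one.trans_le (one_le_log2 _)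
  have h3 : c₂ * (c₁ * (c / (q : ℝ) ^ 2) / log2 q ^ M) / log2 q ^ M ≤ ℓ'' := by
    refine le_trans ?_ h22
    gcongr
    refine le_trans ?_ h12
    gcongr
  have e : c₂ * c₁ * c / 10 / ((q : ℝ) ^ 2 * log2 q ^ (2 * M)) =
      c₂ * (c₁ * (c / (q : ℝ) ^ 2) / log2 q ^ M) / log2 q ^ M / 10 := by
    rw [mul_comm 2 M, pow_mul]
    field_simp
  rw [e]
  gcongr

/-- Inversion of `ℓ ≤ (2 K (ℓ' / 5) + 1) 2 ℓ'` for covering numbers of power growth. -/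
theorem lower_bound_of_rpow_cover {K : ℝ → ℕ} {C s : ℝ} (hC : 0 ≤ C) (hs0 : 0 ≤ s) (hs1 : s < 1)
    (h : ∀ δ, 0 < δ → δ ≤ 1 → (K δ : ℝ) ≤ C * δ ^ (-s)) :
    ∃ c : ℝ, 0 < c ∧ ∀ ℓ ℓ' : ℝ, 0 < ℓ → 0 < ℓ' → ℓ' ≤ 1 →
      ℓ ≤ (2 * (K (ℓ' / 5) : ℝ) + 1) * (2 * ℓ') → c * ℓ ^ (1 / (1 - s)) ≤ ℓ' := by
  have h1s : 0 < 1 - s := by linarith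
  set B : ℝ := (2 * C + 1) * 2 * 5 ^ s with hB
  have hB0 : 0 < B := by positivity
  refine ⟨B⁻¹ ^ (1 / (1 - s)), by positivity, fun ℓ ℓ' hℓ hℓ' hℓ'1 hle => ?_⟩
  have h1 := h (ℓ' / 5) (by positivity) (by linarith)
  have h2 : 1 ≤ (ℓ' / 5) ^ (-s) :=
    Real.one_le_rpow_of_pos_of_le_one_of_nonpos (by positivity) (by linarith) (by linarith)
  have h3 : (ℓ' / 5) ^ (-s) * ℓ' = 5 ^ s * ℓ' ^ (1 - s) := by
    rw [Real.div_rpow hℓ'.le (by norm_num), Real.rpow_neg (by norm_num : (0 : ℝ) ≤ 5), div_inv_eq_mul,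
      show 1 - s = -s + 1 by ring, Real.rpow_add_one hℓ'.ne']
    ring
  have h4 : ℓ ≤ B * ℓ' ^ (1 - s) := by
    have e : B * ℓ' ^ (1 - s) = (2 * C + 1) * 2 * ((ℓ' / 5) ^ (-s) * ℓ') := by rw [h3, hB]; ring
    rw [e]
    refine hle.trans ?_
    nlinarith
  have h5 : B⁻¹ * ℓ ≤ ℓ' ^ (1 - s) := by
    rw [inv_mul_le_iff₀ hB0]; exact h4
  have h6 := Real.rpow_le_rpow (by positivity) h5 (show 0 ≤ 1 / (1 - s) by positivity)
  rw [← Real.rpow_mul hℓ'.le, mul_one_div_cancel h1s.ne', Real.rpow_one,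
    Real.mul_rpow (by positivity) hℓ.le] at h6
  exact h6

/-- Covering bounds hold only for `s > d`; the loss `η` absorbs the difference, by continuity. -/
theorem exists_exponent {d η : ℝ} (hd : d < 1) (hη : 0 < η) :
    ∃ s, d < s ∧ s < 1 ∧ 2 / (1 - s) ^ 2 < 2 / (1 - d) ^ 2 + η := by
  have hcont : ContinuousAt (fun s : ℝ => 2 / (1 - s) ^ 2) d := by
    refine ContinuousAt.div (by fun_prop) (by fun_prop) ?_
    have : 1 - d ≠ 0 := by linarith
    positivity
  have h1 : ∀ᶠ s in nhds d, 2 / (1 - s) ^ 2 < 2 / (1 - d) ^ 2 + η :=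
    hcont.eventually_lt continuousAt_const (by linarith)
  have h2 : ∀ᶠ s in nhds d, s < 1 := eventually_lt_nhds hd
  obtain ⟨s, hs, hds⟩ := (((h1.and h2).filter_mono nhdsWithin_le_nhds).and
    (self_mem_nhdsWithin : Ioi d ∈ nhdsWithin d (Ioi d))).exists
  exact ⟨s, hds, hs.2, hs.1⟩

theorem upperMinkowskiDim_nonneg (Ω : Set ℝ) : 0 ≤ upperMinkowskiDim Ω :=
  Real.sInf_nonneg fun _ hs => hs.1

theorem exists_isPowerAngle {Ω : Set ℝ} (hΩ : Ω ⊆ Icc 0 (Real.pi / 2)) {d : ℝ}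
    (hd : upperMinkowskiDim Ω = d) (hd1 : d < 1) :
    ∃ α : ℝ, ∀ η : ℝ, 0 < η → IsPowerAngle d η Ω α := by
  have hd0 : 0 ≤ d := hd ▸ upperMinkowskiDim_nonneg Ω
  set K := coverNum (directions Ω) with hK
  have hcovD : ∀ s, d < s → ∃ C : ℝ, 0 ≤ C ∧ ∀ δ, 0 < δ → δ ≤ 1 →
      HasCover (directions Ω) δ (C * δ ^ (-s)) := by
    intro s hs
    obtain ⟨C, hC, hcov⟩ := hasCover_of_upperMinkowskiDim_lt hΩ (hd.trans_lt hs)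
    refine ⟨2 * C + 2, by positivity, fun δ hδ hδ1 => ?_⟩
    refine (hcov δ hδ hδ1).directions hδ.le |>.mono le_rfl ?_
    have : 1 ≤ δ ^ (-s) :=
      Real.one_le_rpow_of_pos_of_le_one_of_nonpos hδ hδ1 (by linarith)
    linarith
  obtain ⟨s₀, hs₀, hs₀1⟩ := exists_between hd1
  obtain ⟨C₀, hC₀, hcov₀⟩ := hcovD s₀ hs₀
  have hdecay := decay_of_rpow_bound (K := K) hs₀1 hC₀
    (fun δ hδ hδ1 => (hcov₀ δ hδ hδ1).coverNum_le.1)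
  -- The angle is fixed before `η`: `s₀` serves only to show that the covering numbers permit the
  -- construction.
  obtain ⟨α, -, c, hc, hq⟩ := exists_badly_approximable_angle hΩ
    (fun δ hδ hδ1 => (hcov₀ δ hδ hδ1).coverNum_le.2) hdecay
  refine ⟨α, fun η hη => ?_⟩
  obtain ⟨s, hds, hs1, hsη⟩ := exists_exponent hd1 hη
  obtain ⟨C, hC, hcov⟩ := hcovD s hds
  obtain ⟨c₁, hc₁, h1⟩ := lower_bound_of_rpow_cover (K := K) hC (hd0.trans hds.le) hs1
    (fun δ hδ hδ1 => (hcov δ hδ hδ1).coverNum_le.1)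
  set e := 1 / (1 - s) with he
  have he0 : 0 < e := by
    have : 0 < 1 - s := by linarith
    positivity
  refine ⟨c₁ * (c₁ * c ^ e) ^ e / 10, by positivity, fun θ hθ p q hq1 => ?_⟩
  obtain ⟨ℓ, ℓ', ℓ'', h01, h02, h03, h04, h05, h06, h07, h08⟩ := hq q hq1
  have hq0 : (1 : ℝ) ≤ q := by exact_mod_cast hq1
  have hcq : 0 < c / (q : ℝ) ^ 2 := by positivity
  have h11 := h1 ℓ ℓ' (hcq.trans_le h05) h01 h02 h06
  have h12 := h1 ℓ' ℓ'' h01 h03 h04 h07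
  refine lt_of_le_of_lt ?_ (h08 θ hθ p)
  have h13 : c₁ * (c₁ * (c / (q : ℝ) ^ 2) ^ e) ^ e ≤ ℓ'' := by
    refine le_trans ?_ h12
    gcongr
    refine le_trans ?_ h11
    gcongr
  -- Two steps raise `1 / q²` to the power `e² = 1 / (1 - s)²`.
  have e1 : c₁ * (c₁ * (c / (q : ℝ) ^ 2) ^ e) ^ e =
      c₁ * (c₁ * c ^ e) ^ e * (q : ℝ) ^ (-(2 / (1 - s) ^ 2)) := by
    have hq' : (0 : ℝ) < q := by linarith
    have e2 : (c / (q : ℝ) ^ 2) ^ e = c ^ e * (q : ℝ) ^ (-(2 * e)) := by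
      rw [Real.div_rpow hc.le (by positivity), ← Real.rpow_two, ← Real.rpow_mul hq'.le,
        Real.rpow_neg hq'.le, div_eq_mul_inv]
    rw [e2, ← mul_assoc, Real.mul_rpow (by positivity) (by positivity), ← Real.rpow_mul hq'.le,
      ← mul_assoc]
    congr 2
    rw [he]
    have : 1 - s ≠ 0 := by linarith
    field_simp
  rw [e1] at h13
  have h14 : (q : ℝ) ^ (-(2 / (1 - d) ^ 2) - η) ≤ (q : ℝ) ^ (-(2 / (1 - s) ^ 2)) :=
    Real.rpow_le_rpow_of_exponent_le hq0 (by linarith)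
  calc c₁ * (c₁ * c ^ e) ^ e / 10 * (q : ℝ) ^ (-(2 / (1 - d) ^ 2) - η)
      ≤ c₁ * (c₁ * c ^ e) ^ e / 10 * (q : ℝ) ^ (-(2 / (1 - s) ^ 2)) := by gcongr
    _ = c₁ * (c₁ * c ^ e) ^ e * (q : ℝ) ^ (-(2 / (1 - s) ^ 2)) / 10 := by ring
    _ ≤ ℓ'' / 10 := by gcongr

end DirDisc

end

theorem lemma5p1 (Ω : Set ℝ) (hΩ : Ω ⊆ Set.Icc 0 (Real.pi / 2)) :
    (∀ M : ℕ, 1 ≤ M → DirDisc.IsLacunaryOfOrder M Ω →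
      (∃ α ∈ Set.Icc 0 (Real.pi / 2), DirDisc.IsLogAngle M Ω α) ∧
      ∀ α : ℝ, DirDisc.IsLogAngle M Ω α →
        ∃ C : ℝ, ∀ N : ℕ, 1 ≤ N → ∀ R ∈ DirDisc.admissibleRectangles Ω α N,
          DirDisc.MeanSquareDiscrepancyLE R (C * DirDisc.log2 N ^ (4 * M + 1))) ∧
    (∀ d τ : ℝ, DirDisc.upperMinkowskiDim Ω = d → d < 1 → τ = 2 / (1 - d) ^ 2 - 2 → τ < 1 →
      (∃ α : ℝ, ∀ η : ℝ, 0 < η → DirDisc.IsPowerAngle d η Ω α) ∧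
      ∀ ε : ℝ, 0 < ε → ∃ η : ℝ, 0 < η ∧ ∀ α : ℝ, DirDisc.IsPowerAngle d η Ω α →
        ∃ C : ℝ, ∀ N : ℕ, 1 ≤ N → ∀ R ∈ DirDisc.admissibleRectangles Ω α N,
          DirDisc.MeanSquareDiscrepancyLE R (C * (N : ℝ) ^ (τ / (τ + 1) + ε))) := by
  refine ⟨fun M _ hlac => ⟨DirDisc.exists_isLogAngle hΩ hlac,
    fun α hα => DirDisc.discrepancy_bound_of_isLogAngle hα⟩, fun d τ hd hd1 hτ hτ1 =>
    ⟨DirDisc.exists_isPowerAngle hΩ hd hd1, fun ε hε => ?_⟩⟩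
  have hd0 : 0 ≤ d := hd ▸ DirDisc.upperMinkowskiDim_nonneg Ω
  refine DirDisc.discrepancy_bound_of_isPowerAngle ?_ hτ1 hτ hε
  rw [hτ, sub_nonneg, le_div_iff₀ (by nlinarith)]
  nlinarith
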